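/- **Setting.** For each $n$ let $X_{n,1},\dots,X_{n,n}$ be independent real random variables (a triangular array). Assume $X_{n,i}$ has a law that is absolutely continuous with respect to Lebesgue measure, with mean $\mu_{n,i}$ and finite variance $\sigma_{n,i}^2$, $\sigma_{n,i}>0$. Write $X_i,\mu_i,\sigma_i$ for short, and put $$U_n^{\rm Ken}=\frac{1}{n(n-1)}\sum_{i\ne j}\mathbf 1(j<i)\,\mathbf 1(X_j>X_i),\qquad U_n^{\rm AP}=\frac{1}{n(n-1)}\sum_{i\ne j}\frac{n\,\mathbf 1(j<i)}{i-1}\,\mathbf 1(X_j>X_i)$$ (with $0/0:=0$), $$R_n=\max_{1\le i\ne j\le n}\Big|\frac{\mu_i-\mu_j}{\sigma_i}\Big|,\qquad \rho_n=\max_{1\le i\ne j\le n}\frac{\sigma_i}{\sigma_j},$$ $$F_j^c(t)=P\Big(\frac{X_j-\mu_j}{\sigma_j}>t\Big),\qquad F_{ji}^c(t)=P\Big\{\frac{X_j-X_i-(\mu_j-\mu_i)}{(\sigma_i^2+\sigma_j^2)^{1/2}}>t\Big\}.$$ A statistic $U_n$ is *asymptotically normal* if ${\rm Var}(U_n)^{-1/2}\{U_n-E(U_n)\}\to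 N(0,1)$ in distribution. For real sequences, $a_n\lesssim b_n$ means that for some constant $C$, $|a_n|\le C|b_n|$ for all large $n$; $a_n\lnsim b_n$ means that $a_n\lesssim b_n$ holds and $b_n\lesssim a_n$ does not. **Theorem.** (i) Assume there are constants $c_1,c_2>0$, $b_1>b_2>0$, $t_0>0$ such that for all $n$, all $1\le i\ne j\le n$ and all $t\ge t_0$, $$c_1t^{-b_1}\le F_j^c(t)\le c_2t^{-b_2},\qquad c_1t^{-b_1}\le F_{ji}^c(t)\le c_2t^{-b_2}.$$ If $$R_n^{(3b_1b_2+b_1^2)/b_2}\rho_n^{b_1}\lnsim n^{1/3}\quad\text{and}\quad \rho_n^{b_1}\lesssim n^{1/3},$$ then $U_n^{\rm Ken}$ is asymptotically normal. If $$R_n^{(3b_1b_2+b_1^2)/b_2}\rho_n^{b_1}\lnsim n^{1/3}(\log n)^{-2}\quad\text{and}\quad \rho_n^{b_1}\lesssim n^{1/3}(\log n)^{-2},$$ then $U_n^{\rm AP}$ is asymptotically normal. (When $R_n$ is bounded away from $0$, the second condition in each pair follows from the first.) (ii) Assume there are constants $\lambda>0$, $c_1,c_2>0$ with $c_1\le 2c_2$,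 $b_1>b_2>0$, $t_0>0$ such that for all $n$, all $1\le i\ne j\le n$ and all $t\ge t_0$, $$c_1e^{-b_1t^\lambda}\le F_j^c(t)\le c_2e^{-b_2t^\lambda},\qquad c_1e^{-b_1t^\lambda}\le F_{ji}^c(t)\le c_2e^{-b_2t^\lambda}.$$ Let $\xi(p)=1$ for $p\le 1$, $\xi(p)=2^{p-1}$ for $p>1$, and $$K_3=t_0+\Big(-\frac1{b_2}\log\frac{c_1}{2c_2}+\frac{b_1}{b_2}t_0^\lambda\Big)^{1/\lambda}+\xi(\lambda^{-1})\Big(-\frac1{b_2}\log\frac{c_1}{2c_2}\Big)^{1/\lambda},\qquad K_4=\xi(\lambda^{-1})\Big(\frac{b_1}{b_2}\Big)^{1/\lambda},$$ $$L_n=3b_1R_n^\lambda+b_1(R_n+K_3\rho_n+K_4\rho_nR_n)^\lambda.$$ If $\exp(L_n)\lnsim \exp\big(\tfrac13\log n\big)=n^{1/3}$, then $U_n^{\rm Ken}$ is asymptotically normal. If $\exp(L_n)\lnsim \exp\big(\tfrac13\log n-2\log\log n\big)=n^{1/3}(\log n)^{-2}$, then $U_n^{\rm AP}$ is asymptotically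 normal. -/

import Mathlib

open MeasureTheory ProbabilityTheory Filter Topology Asymptotics

noncomputable section

namespace RankCLT

/-- `a ≲ b` up to an absolute constant, for all large `n`, while `b ≲ a` fails. -/
def StrictlyLesssim (a b : ℕ → ℝ) : Prop :=
  a =O[atTop] b ∧ ¬ b =O[atTop] a

/-- Transformed Kendall's tau of `x 0, …, x (n-1)`:
`1 / (n (n - 1)) * ∑_{i ≠ j} 1(j < i) 1(x j > x i)`. -/
def kendall {n : ℕ} (x : Fin n → ℝ) : ℝ :=
  1 / ((n : ℝ) * ((n : ℝ) - 1)) *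
    ∑ i : Fin n, ∑ j : Fin n, if j < i ∧ x i < x j then (1 : ℝ) else 0

/-- Transformed average-precision correlation of `x 0, …, x (n-1)`. The weight of a pair `j < i` is
`n` divided by the number of indices below `i`, which is `(i : ℕ)` as `Fin n` starts at `0`. -/
def avgPrecision {n : ℕ} (x : Fin n → ℝ) : ℝ :=
  1 / ((n : ℝ) * ((n : ℝ) - 1)) *
    ∑ i : Fin n, ∑ j : Fin n, if j < i ∧ x i < x j then (n : ℝ) / ((i : ℕ) : ℝ) else 0

/-- `Var(U_n)^{-1/2} (U_n - E U_n)` converges in distribution to `N(0, 1)`. -/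
def AsymptoticallyNormal {Ω : ℕ → Type*} [∀ n, MeasurableSpace (Ω n)]
    (P : ∀ n, Measure (Ω n)) [∀ n, IsProbabilityMeasure (P n)] (U : ∀ n, Ω n → ℝ) : Prop :=
  TendstoInDistribution
    (fun n ω => (√(Var[U n; P n]))⁻¹ * (U n ω - ∫ ω', U n ω' ∂(P n)))
    atTop (fun x : ℝ => x) P (gaussianReal 0 1)

/-- One row of the location-scale model: independent real random variables `X i` with absolutely
continuous laws, means `μ i` and variances `(σ i)²`, `σ i > 0`. -/
structure LocationScale {n : ℕ} {Ω : Type*} [MeasurableSpace Ω] (P : Measure Ω)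
    (X : Fin n → Ω → ℝ) (μ σ : Fin n → ℝ) : Prop where
  measurable : ∀ i, Measurable (X i)
  indep : iIndepFun X P
  absCont : ∀ i, P.map (X i) ≪ volume
  memLp : ∀ i, MemLp (X i) 2 P
  mean : ∀ i, ∫ ω, X i ω ∂P = μ i
  sigma_pos : ∀ i, 0 < σ i
  variance : ∀ i, Var[X i; P] = σ i ^ 2

/-- `R = max_{i ≠ j} |(μ i - μ j) / σ i|` (a maximum as soon as `2 ≤ n`). -/
def spread {n : ℕ} (μ σ : Fin n → ℝ) : ℝ :=
  ⨆ p : {p : Fin n × Fin n // p.1 ≠ p.2}, |(μ p.1.1 - μ p.1.2) / σ p.1.1|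

/-- `ρ = max_{i ≠ j} σ i / σ j` (a maximum as soon as `2 ≤ n`). -/
def scaleRatio {n : ℕ} (σ : Fin n → ℝ) : ℝ :=
  ⨆ p : {p : Fin n × Fin n // p.1 ≠ p.2}, σ p.1.1 / σ p.1.2

/-- `P((X j - μ j) / σ j > t)`. -/
def survival {n : ℕ} {Ω : Type*} [MeasurableSpace Ω] (P : Measure Ω)
    (X : Fin n → Ω → ℝ) (μ σ : Fin n → ℝ) (j : Fin n) (t : ℝ) : ℝ :=
  P.real {ω | t < (X j ω - μ j) / σ j}

/-- `P((X j - X i - (μ j - μ i)) / (σ i² + σ j²)^{1/2} > t)`. -/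
def survivalDiff {n : ℕ} {Ω : Type*} [MeasurableSpace Ω] (P : Measure Ω)
    (X : Fin n → Ω → ℝ) (μ σ : Fin n → ℝ) (j i : Fin n) (t : ℝ) : ℝ :=
  P.real {ω | t < (X j ω - X i ω - (μ j - μ i)) / √(σ i ^ 2 + σ j ^ 2)}

/-- For all `n`, all `i ≠ j` and all `t ≥ t₀`, both standardized survival functions lie between
`lo t` and `up t`. -/
def TailBounds {Ω : ℕ → Type*} [∀ n, MeasurableSpace (Ω n)] (P : ∀ n, Measure (Ω n))
    (X : ∀ n, Fin n → Ω n → ℝ) (μ σ : ∀ n, Fin n → ℝ) (t₀ : ℝ) (lo up : ℝ → ℝ) : Prop :=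
  ∀ n, ∀ i j : Fin n, i ≠ j → ∀ t, t₀ ≤ t →
    (lo t ≤ survival (P n) (X n) (μ n) (σ n) j t ∧
      survival (P n) (X n) (μ n) (σ n) j t ≤ up t) ∧
    (lo t ≤ survivalDiff (P n) (X n) (μ n) (σ n) j i t ∧
      survivalDiff (P n) (X n) (μ n) (σ n) j i t ≤ up t)

/-- `ξ(p) = 1` for `p ≤ 1` and `ξ(p) = 2^{p-1}` for `p > 1`. -/
def xi (p : ℝ) : ℝ := if p ≤ 1 then 1 else (2 : ℝ) ^ (p - 1)

def K₃ (c₁ c₂ b₁ b₂ t₀ l : ℝ) : ℝ :=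
  t₀ + (-(1 / b₂) * Real.log (c₁ / (2 * c₂)) + b₁ / b₂ * t₀ ^ l) ^ (1 / l)
    + xi (1 / l) * (-(1 / b₂) * Real.log (c₁ / (2 * c₂))) ^ (1 / l)

def K₄ (b₁ b₂ l : ℝ) : ℝ := xi (1 / l) * (b₁ / b₂) ^ (1 / l)

/-- `R^{(3 b₁ b₂ + b₁²) / b₂} ρ^{b₁}`. -/
def heavyRate (b₁ b₂ R ρ : ℝ) : ℝ := R ^ ((3 * b₁ * b₂ + b₁ ^ 2) / b₂) * ρ ^ b₁

/-- `3 b₁ R^l + b₁ (R + K₃ ρ + K₄ ρ R)^l`. -/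
def lightRate (c₁ c₂ b₁ b₂ t₀ l R ρ : ℝ) : ℝ :=
  3 * b₁ * R ^ l + b₁ * (R + K₃ c₁ c₂ b₁ b₂ t₀ l * ρ + K₄ b₁ b₂ l * ρ * R) ^ l

end RankCLT

end

noncomputable section

namespace RankCLT

/-! ### Product measures -/

/-! Both statistics are positive multiples of a weighted count `rankSum w` of inverted pairs, with
weights between `1` and `n / i` in the zero-based index: Kendall's tau takes the lower extreme and
average precision the upper one. One argument covers the whole range.

The Hoeffding decomposition `rankSum_eq` writes the count as a constant, a sum of functions `hajek`
of single coordinates, and a sum of doubly centred kernels. Distinct kernels are orthogonal to each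
other and to every function of one coordinate. Each centred projection term is bounded by `n (2 +
log n)`, and the L² norm of the degenerate part is at most twice that. If the projection has
standard deviation `s` with `n log n = o(s)`, a characteristic function estimate gives a Gaussian
limit for the projection, and the degenerate part is negligible
(`norm_integral_exp_rankSum_sub_le`).

It remains to bound `s` from below. For `k` among the last `n r / 8` indices, few pairs have `k` as
smaller index, so the projection term of `k` is nearly the decreasing function `t ↦ w k * ∑_{j < k}
P(X j > t)`. Between `μ k` and `μ k + (R + M ρ) σ k`, where `R` is the spread and `ρ` the scale
ratio, each survival probability falls from at least `2 r` to at most `r`, so the term drops by at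
least `n r / 2`. `X k` lies below the first point with probability bounded below, and beyond the
second with probability at least `τ`, a lower tail bound at `R + M ρ`. Summing over these `k` gives
`s² ≳ n³ r³ τ` (`le_sum_variance_hajek`).

The tail bounds dictate `r`, `M` and `τ`, and the growth conditions say precisely that `r³ τ ≳
n^(-1/3)`. Hence `s ≳ n^(4/3)`, which dominates `n log n`. -/

lemma measurable_update_prod {ι : Type*} [DecidableEq ι] (m : ι) :
    Measurable (fun p : (ι → ℝ) × ℝ => Function.update p.1 m p.2) := by
  refine measurable_pi_iff.2 fun i => ?_
  by_cases h : i = m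
  · subst h; simpa using measurable_snd
  · simp only [Function.update_of_ne h]; fun_prop

/-- Resampling one coordinate does not change a product of probability measures. -/
lemma map_update_pi {ι : Type*} [Fintype ι] [DecidableEq ι] (ν : ι → Measure ℝ)
    [∀ i, IsProbabilityMeasure (ν i)] (m : ι) :
    ((Measure.pi ν).prod (ν m)).map (fun p : (ι → ℝ) × ℝ => Function.update p.1 m p.2)
      = Measure.pi ν := by
  have hmeas := measurable_update_prod (ι := ι) m
  symm
  refine Measure.pi_eq fun s hs => ?_
  rw [Measure.map_apply hmeas (MeasurableSet.univ_pi hs)]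
  have : (fun p : (ι → ℝ) × ℝ => Function.update p.1 m p.2) ⁻¹' (Set.univ.pi s)
      = (Set.univ.pi (Function.update s m Set.univ)) ×ˢ (s m) := by
    ext ⟨x, y⟩
    simp only [Set.mem_preimage, Set.mem_pi, Set.mem_univ, true_implies, Set.mem_prod]
    constructor
    · intro h
      refine ⟨fun i => ?_, by simpa using h m⟩
      by_cases hi : i = m
      · subst hi; simp
      · simpa [Function.update_of_ne hi] using h i
    · rintro ⟨h, hy⟩ i
      by_cases hi : i = m
      · subst hi; simpa using hy
      · simpa [Function.update_of_ne hi] using h i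
  rw [this, Measure.prod_prod, Measure.pi_pi, ← Finset.prod_erase_mul _ _ (Finset.mem_univ m),
    ← Finset.prod_erase_mul (a := m) Finset.univ (fun i => (ν i) (s i)) (Finset.mem_univ m)]
  simp only [Function.update_self, measure_univ, mul_one]
  congr 1
  refine Finset.prod_congr rfl fun i hi => ?_
  rw [Function.update_of_ne (Finset.ne_of_mem_erase hi)]

/-- Fubini in one coordinate. Resampling, instead of splitting off the coordinate, keeps the inner
integral a function on the whole product. -/
lemma integral_pi_eq_update {ι : Type*} [Fintype ι] [DecidableEq ι] (ν : ι → Measure ℝ)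
    [∀ i, IsProbabilityMeasure (ν i)] (m : ι) {f : (ι → ℝ) → ℝ}
    (hf : Integrable f (Measure.pi ν)) :
    ∫ x, f x ∂(Measure.pi ν) = ∫ x, ∫ y, f (Function.update x m y) ∂(ν m) ∂(Measure.pi ν) := by
  have hm := measurable_update_prod (ι := ι) m
  have hf' := hf
  rw [← map_update_pi ν m] at hf'
  conv_lhs => rw [← map_update_pi ν m]
  rw [integral_map hm.aemeasurable hf'.aestronglyMeasurable,
    integral_prod (fun p : (ι → ℝ) × ℝ => f (Function.update p.1 m p.2))
      ((integrable_map_measure hf'.aestronglyMeasurable hm.aemeasurable).1 hf')]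

/-- A function that is centred in coordinate `m` is orthogonal to every function that does not
depend on coordinate `m`. -/
lemma integral_mul_eq_zero_of_update {ι : Type*} [Fintype ι] [DecidableEq ι] (ν : ι → Measure ℝ)
    [∀ i, IsProbabilityMeasure (ν i)] (m : ι) {u f : (ι → ℝ) → ℝ}
    (hi : Integrable (fun x => u x * f x) (Measure.pi ν))
    (hu : ∀ x y, u (Function.update x m y) = u x)
    (hf : ∀ x, ∫ y, f (Function.update x m y) ∂(ν m) = 0) :
    ∫ x, u x * f x ∂(Measure.pi ν) = 0 := by
  rw [integral_pi_eq_update ν m hi]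
  simp [hu, integral_const_mul, hf]

lemma integral_pi_apply {ι : Type*} [Fintype ι] (ν : ι → Measure ℝ)
    [∀ i, IsProbabilityMeasure (ν i)] (k : ι) {g : ℝ → ℝ} (hg : Measurable g) :
    ∫ x, g (x k) ∂(Measure.pi ν) = ∫ y, g y ∂(ν k) := by
  have h := (measurePreserving_eval ν k).map_eq
  rw [← h, integral_map (measurable_pi_apply k).aemeasurable hg.aestronglyMeasurable]

lemma integrable_of_bounded {α : Type*} [MeasurableSpace α] {P : Measure α} [IsFiniteMeasure P]
    {f : α → ℝ} (hf : Measurable f) {C : ℝ} (hC : ∀ x, |f x| ≤ C) : Integrable f P :=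
  Integrable.of_bound hf.aestronglyMeasurable C (ae_of_all _ hC)

/-! ### A quantitative central limit theorem for bounded summands -/

/-- Factors are exchanged one at a time; the remaining factors have norm at most one, so the errors
only add. -/
lemma norm_prod_sub_prod_le_sum {ι : Type*} (s : Finset ι) (a b : ι → ℂ)
    (ha : ∀ i ∈ s, ‖a i‖ ≤ 1) (hb : ∀ i ∈ s, ‖b i‖ ≤ 1) :
    ‖∏ i ∈ s, a i - ∏ i ∈ s, b i‖ ≤ ∑ i ∈ s, ‖a i - b i‖ := by
  classical
  induction s using Finset.induction_on with
  | empty => simp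
  | insert i s hi ih =>
    rw [Finset.prod_insert hi, Finset.prod_insert hi, Finset.sum_insert hi]
    have ih' := ih (fun j hj => ha j (Finset.mem_insert_of_mem hj))
      (fun j hj => hb j (Finset.mem_insert_of_mem hj))
    have h1 : ‖∏ j ∈ s, a j‖ ≤ 1 := by
      rw [norm_prod]
      exact Finset.prod_le_one (fun _ _ => norm_nonneg _)
        (fun j hj => ha j (Finset.mem_insert_of_mem hj))
    have h2 := hb i (Finset.mem_insert_self _ _)
    calc ‖a i * ∏ j ∈ s, a j - b i * ∏ j ∈ s, b j‖
        = ‖(a i - b i) * ∏ j ∈ s, a j + b i * (∏ j ∈ s, a j - ∏ j ∈ s, b j)‖ := by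
          congr 1; ring
      _ ≤ ‖a i - b i‖ * ‖∏ j ∈ s, a j‖ + ‖b i‖ * ‖∏ j ∈ s, a j - ∏ j ∈ s, b j‖ := by
          refine (norm_add_le _ _).trans ?_
          rw [norm_mul, norm_mul]
      _ ≤ ‖a i - b i‖ * 1 + 1 * ∑ j ∈ s, ‖a j - b j‖ := by gcongr
      _ = _ := by ring

lemma norm_exp_I_mul_sub_taylor_le {u : ℝ} (hu : |u| ≤ 1) :
    ‖Complex.exp (u * Complex.I) - (1 + u * Complex.I - u ^ 2 / 2)‖ ≤ 3 * (|u| * u ^ 2) := by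
  have h := Complex.norm_exp_sub_sum_le_norm_mul_exp (u * Complex.I) 3
  have hn : ‖(u : ℂ) * Complex.I‖ = |u| := by simp
  have hs : ∑ m ∈ Finset.range 3, ((u : ℂ) * Complex.I) ^ m / (m.factorial : ℂ)
      = 1 + u * Complex.I - u ^ 2 / 2 := by
    simp [Finset.sum_range_succ, Nat.factorial, mul_pow]
    ring
  rw [hn, hs] at h
  refine h.trans ?_
  have he : Real.exp |u| ≤ 3 :=
    (Real.exp_le_exp.2 hu).trans (by have := Real.exp_one_lt_d9; linarith)
  calc |u| ^ 3 * Real.exp |u| ≤ |u| ^ 3 * 3 := by gcongr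
    _ = 3 * (|u| * |u| ^ 2) := by ring
    _ = _ := by rw [sq_abs]

/-- Both terms are compared with `1 - v / 2`, where `v` is the variance: the cubic Taylor remainder
costs `3 ε v`, and `v ≤ ε²` makes the second-order remainder of the Gaussian factor at most `ε v`.
The bound is linear in `v`, so it can be summed over independent coordinates. -/
lemma norm_integral_exp_sub_exp_le (ν : Measure ℝ) [IsProbabilityMeasure ν] {g : ℝ → ℝ}
    (hg : Measurable g) {ε : ℝ} (hε : ε ≤ 1) (hb : ∀ x, |g x| ≤ ε) (h0 : ∫ x, g x ∂ν = 0) :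
    ‖∫ x, Complex.exp (g x * Complex.I) ∂ν - Complex.exp (-(((∫ x, g x ^ 2 ∂ν : ℝ) : ℂ) / 2))‖
      ≤ 4 * ε * ∫ x, g x ^ 2 ∂ν := by
  set v := ∫ x, g x ^ 2 ∂ν with hv
  have hε0 : 0 ≤ ε := (abs_nonneg _).trans (hb 0)
  have hsq : ∀ x, g x ^ 2 ≤ ε ^ 2 := fun x => by
    rw [← sq_abs]; exact pow_le_pow_left₀ (abs_nonneg _) (hb x) 2
  have hgi : Integrable g ν := integrable_of_bounded hg hb
  have hg2 : Integrable (fun x => g x ^ 2) ν :=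
    integrable_of_bounded (hg.pow_const 2) (C := ε ^ 2) fun x => by
      rw [abs_of_nonneg (sq_nonneg _)]; exact hsq x
  have hv0 : 0 ≤ v := integral_nonneg fun x => sq_nonneg _
  have hvε : v ≤ ε ^ 2 := by
    calc v ≤ ∫ _, ε ^ 2 ∂ν := integral_mono hg2 (integrable_const _) hsq
      _ = ε ^ 2 := by simp
  have hei : Integrable (fun x => Complex.exp (g x * Complex.I)) ν := by
    refine Integrable.of_bound (by fun_prop) 1 (ae_of_all _ fun x => ?_)
    rw [Complex.norm_exp_ofReal_mul_I]
  have hgc : Integrable (fun x => (g x : ℂ) * Complex.I) ν := hgi.ofReal.mul_const _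
  have hg2c : Integrable (fun x => (g x : ℂ) ^ 2 / 2) ν := by
    have := (hg2.ofReal (𝕜 := ℂ)).div_const 2
    simpa using this
  have h1c : Integrable (fun x => 1 + (g x : ℂ) * Complex.I) ν := (integrable_const _).add hgc
  have hTi : Integrable (fun x => 1 + (g x : ℂ) * Complex.I - (g x : ℂ) ^ 2 / 2) ν :=
    h1c.sub hg2c
  have hT : ∫ x, (1 + (g x : ℂ) * Complex.I - (g x : ℂ) ^ 2 / 2) ∂ν = 1 - (v : ℂ) / 2 := by
    rw [integral_sub h1c hg2c, integral_add (integrable_const _) hgc,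
      integral_mul_const, integral_div]
    have e1 : ∫ x, (g x : ℂ) ∂ν = 0 := by
      rw [integral_complex_ofReal, h0]; simp
    have e2 : ∫ x, (g x : ℂ) ^ 2 ∂ν = (v : ℂ) := by
      rw [hv, ← integral_complex_ofReal]; simp
    rw [e1, e2]; simp
  have h1 : ‖∫ x, Complex.exp (g x * Complex.I) ∂ν - (1 - (v : ℂ) / 2)‖ ≤ 3 * ε * v := by
    rw [← hT, ← integral_sub hei hTi]
    calc _ ≤ ∫ x, 3 * ε * g x ^ 2 ∂ν := by
          refine norm_integral_le_of_norm_le (hg2.const_mul _) (ae_of_all _ fun x => ?_)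
          refine (norm_exp_I_mul_sub_taylor_le ((hb x).trans hε)).trans ?_
          rw [mul_assoc]
          gcongr
          exact hb x
      _ = _ := by rw [integral_const_mul]
  have h2 : ‖(1 - (v : ℂ) / 2) - Complex.exp (-((v : ℂ) / 2))‖ ≤ ε * v := by
    have hv1 : |(-(v / 2))| ≤ 1 := by
      rw [abs_neg, abs_of_nonneg (by positivity)]; nlinarith
    have := Real.abs_exp_sub_one_sub_id_le hv1
    have e : (1 - (v : ℂ) / 2) - Complex.exp (-((v : ℂ) / 2))
        = ((-(Real.exp (-(v / 2)) - 1 - -(v / 2)) : ℝ) : ℂ) := by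
      push_cast; ring
    rw [e, Complex.norm_real, Real.norm_eq_abs, abs_neg]
    refine this.trans ?_
    nlinarith [mul_nonneg hv0 hε0, mul_nonneg hv0 (sub_nonneg.2 hvε),
      mul_nonneg hv0 (mul_nonneg hε0 (sub_nonneg.2 hε))]
  calc _ = ‖(∫ x, Complex.exp (g x * Complex.I) ∂ν - (1 - (v : ℂ) / 2))
        + ((1 - (v : ℂ) / 2) - Complex.exp (-((v : ℂ) / 2)))‖ := by congr 1; ring
    _ ≤ 3 * ε * v + ε * v := (norm_add_le _ _).trans (add_le_add h1 h2)
    _ = _ := by ring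

/-- Characteristic function of a normalized sum of independent bounded centred variables. -/
lemma norm_integral_exp_sum_sub_le {ι : Type*} [Fintype ι] (ν : ι → Measure ℝ)
    [∀ i, IsProbabilityMeasure (ν i)] {g : ι → ℝ → ℝ} (hg : ∀ k, Measurable (g k)) {B s : ℝ}
    (hB : ∀ k x, |g k x| ≤ B) (h0 : ∀ k, ∫ x, g k x ∂(ν k) = 0) (hs : 0 < s)
    (hsum : ∑ k, ∫ x, g k x ^ 2 ∂(ν k) = s ^ 2) (t : ℝ) (ht : |t| * B / s ≤ 1) :
    ‖∫ x, Complex.exp (((t * (∑ k, g k (x k)) / s : ℝ) : ℂ) * Complex.I) ∂(Measure.pi ν)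
        - Complex.exp (-((t : ℂ) ^ 2 / 2))‖ ≤ 4 * (|t| * B / s) * t ^ 2 := by
  have e1 : ∀ x : ι → ℝ, Complex.exp (((t * (∑ k, g k (x k)) / s : ℝ) : ℂ) * Complex.I)
      = ∏ k, Complex.exp (((t / s * g k (x k) : ℝ) : ℂ) * Complex.I) := by
    intro x
    rw [← Complex.exp_sum, ← Finset.sum_mul, ← Complex.ofReal_sum, ← Finset.mul_sum]
    congr 3; ring
  have hv : ∀ k, ∫ x, (t / s * g k x) ^ 2 ∂(ν k) = t ^ 2 / s ^ 2 * ∫ x, g k x ^ 2 ∂(ν k) := by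
    intro k
    rw [← integral_const_mul]
    congr 1; ext x; ring
  have hvs : ∑ k, ∫ x, (t / s * g k x) ^ 2 ∂(ν k) = t ^ 2 := by
    simp_rw [hv]
    rw [← Finset.mul_sum, hsum]; field_simp
  -- The Gaussian characteristic function is factored with the same variances as the summands, so
  -- the two products can be compared factor by factor.
  have e2 : Complex.exp (-((t : ℂ) ^ 2 / 2))
      = ∏ k, Complex.exp (-(((∫ x, (t / s * g k x) ^ 2 ∂(ν k) : ℝ) : ℂ) / 2)) := by
    rw [← Complex.exp_sum, Finset.sum_neg_distrib, ← Finset.sum_div, ← Complex.ofReal_sum, hvs]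
    push_cast; rfl
  simp_rw [e1]
  rw [e2, integral_fintype_prod_eq_prod
    (f := fun k (y : ℝ) => Complex.exp (((t / s * g k y : ℝ) : ℂ) * Complex.I))]
  refine (norm_prod_sub_prod_le_sum _ _ _ (fun k _ => ?_) (fun k _ => ?_)).trans ?_
  · refine (norm_integral_le_of_norm_le_const (C := 1) (ae_of_all _ fun x => ?_)).trans ?_
    · rw [Complex.norm_exp_ofReal_mul_I]
    · simp
  · rw [Complex.norm_exp]
    have : 0 ≤ ∫ x, (t / s * g k x) ^ 2 ∂(ν k) := integral_nonneg fun x => sq_nonneg _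
    have e : (-(((∫ x, (t / s * g k x) ^ 2 ∂(ν k) : ℝ) : ℂ) / 2)).re
        = -((∫ x, (t / s * g k x) ^ 2 ∂(ν k)) / 2) := by
      rw [← Complex.ofReal_ofNat, ← Complex.ofReal_div, ← Complex.ofReal_neg, Complex.ofReal_re]
    rw [e, Real.exp_le_one_iff]; linarith
  · calc _ ≤ ∑ k, 4 * (|t| * B / s) * ∫ x, (t / s * g k x) ^ 2 ∂(ν k) := by
          refine Finset.sum_le_sum fun k _ => ?_
          refine norm_integral_exp_sub_exp_le (ν k) ((hg k).const_mul _) ht (fun x => ?_) ?_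
          · rw [abs_mul, abs_div, abs_of_pos hs, div_mul_eq_mul_div]
            gcongr
            exact hB k x
          · rw [integral_const_mul, h0, mul_zero]
      _ = _ := by rw [← Finset.mul_sum, hvs]

lemma norm_exp_mul_I_sub_le (a b : ℝ) :
    ‖Complex.exp (a * Complex.I) - Complex.exp (b * Complex.I)‖ ≤ |a - b| := by
  have e : Complex.exp (a * Complex.I) - Complex.exp (b * Complex.I)
      = Complex.exp (b * Complex.I) * (Complex.exp (Complex.I * ((a - b : ℝ) : ℂ)) - 1) := by
    rw [mul_sub, ← Complex.exp_add, mul_one]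
    congr 2; push_cast; ring
  rw [e, norm_mul, Complex.norm_exp_ofReal_mul_I, one_mul]
  exact Real.norm_exp_I_mul_ofReal_sub_one_le

/-- With `z = q² / s²` this bounds the ratio of the standard deviations before and after the
perturbation. -/
lemma one_sub_half_le_inv_sqrt {z : ℝ} (hz : 0 ≤ z) : 1 - z / 2 ≤ (√(1 + z))⁻¹ := by
  have h1 : 0 < √(1 + z) := Real.sqrt_pos.2 (by linarith)
  have h2 : √(1 + z) ≤ 1 + z / 2 := by
    rw [Real.sqrt_le_left (by linarith)]; nlinarith [sq_nonneg z]
  have h3 : (1 + z / 2)⁻¹ ≤ (√(1 + z))⁻¹ := inv_anti₀ h1 h2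
  refine le_trans ?_ h3
  rw [← one_div, le_div_iff₀ (by linarith)]
  nlinarith [sq_nonneg z]

lemma integral_abs_le_sqrt {α : Type*} [MeasurableSpace α] (P : Measure α)
    [IsProbabilityMeasure P] {f : α → ℝ} (hf : MemLp f 2 P) :
    ∫ x, |f x| ∂P ≤ √(∫ x, f x ^ 2 ∂P) := by
  refine Real.le_sqrt_of_sq_le ?_
  have h := variance_nonneg (fun x => |f x|) P
  have hm : MemLp (fun x => |f x|) 2 P := hf.abs
  rw [variance_eq_sub hm] at h
  simp only [Pi.pow_apply, sq_abs] at h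
  linarith

/-- Adding an orthogonal perturbation and renormalizing changes the characteristic function little. -/
lemma norm_integral_exp_perturb_le {α : Type*} [MeasurableSpace α] (P : Measure α)
    [IsProbabilityMeasure P] {H D : α → ℝ} (hH : Measurable H) (hD : Measurable D) {C : ℝ}
    (hHC : ∀ x, |H x| ≤ C) (hDC : ∀ x, |D x| ≤ C) {s q : ℝ} (hs : 0 < s) (hq : 0 ≤ q)
    (hHs : ∫ x, H x ^ 2 ∂P = s ^ 2) (hDq : ∫ x, D x ^ 2 ∂P = q ^ 2)
    (hHD : ∫ x, H x * D x ∂P = 0) (t : ℝ) :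
    ‖∫ x, Complex.exp (((t * (H x + D x) / √(s ^ 2 + q ^ 2) : ℝ) : ℂ) * Complex.I) ∂P
      - ∫ x, Complex.exp (((t * H x / s : ℝ) : ℂ) * Complex.I) ∂P‖ ≤ |t| * (q / s) := by
  set S := √(s ^ 2 + q ^ 2) with hS
  have hS2 : S ^ 2 = s ^ 2 + q ^ 2 := Real.sq_sqrt (by positivity)
  have hS0 : 0 < S := Real.sqrt_pos.2 (by positivity)
  have hC0 : 0 ≤ C := by
    obtain ⟨x⟩ := P.nonempty_of_neZero
    exact (abs_nonneg _).trans (hHC x)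
  have hH2 : MemLp H 2 P := MemLp.of_bound hH.aestronglyMeasurable C (ae_of_all _ hHC)
  have hD2 : MemLp D 2 P := MemLp.of_bound hD.aestronglyMeasurable C (ae_of_all _ hDC)
  -- `Y` is the difference of the two normalized variables. Orthogonality gives `E Y² = 2 - 2 s /
  -- S`, which is at most `q² / s²`.
  set Y : α → ℝ := fun x => (S⁻¹ - s⁻¹) * H x + S⁻¹ * D x with hY
  have hY2 : MemLp Y 2 P := (hH2.const_mul _).add (hD2.const_mul _)
  have hYsq : ∫ x, Y x ^ 2 ∂P ≤ (q / s) ^ 2 := by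
    have e : ∀ x, Y x ^ 2 = (S⁻¹ - s⁻¹) ^ 2 * H x ^ 2 + 2 * (S⁻¹ - s⁻¹) * S⁻¹ * (H x * D x)
        + S⁻¹ ^ 2 * D x ^ 2 := fun x => by rw [hY]; ring
    have i1 : Integrable (fun x => (S⁻¹ - s⁻¹) ^ 2 * H x ^ 2) P := hH2.integrable_sq.const_mul _
    have i2 : Integrable (fun x => 2 * (S⁻¹ - s⁻¹) * S⁻¹ * (H x * D x)) P :=
      (hH2.integrable_mul hD2).const_mul _
    have i3 : Integrable (fun x => S⁻¹ ^ 2 * D x ^ 2) P := hD2.integrable_sq.const_mul _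
    have i12 : Integrable (fun x => (S⁻¹ - s⁻¹) ^ 2 * H x ^ 2
        + 2 * (S⁻¹ - s⁻¹) * S⁻¹ * (H x * D x)) P := i1.add i2
    simp_rw [e]
    rw [integral_add i12 i3, integral_add i1 i2, integral_const_mul, integral_const_mul,
      integral_const_mul, hHs, hDq, hHD]
    have hz := one_sub_half_le_inv_sqrt (z := q ^ 2 / s ^ 2) (by positivity)
    have hz' : √(1 + q ^ 2 / s ^ 2) = S / s := by
      rw [hS, ← Real.sqrt_sq hs.le, ← Real.sqrt_div (by positivity), Real.sqrt_sq hs.le]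
      congr 1; field_simp
    rw [hz', inv_div] at hz
    have e2 : (S⁻¹ - s⁻¹) ^ 2 * s ^ 2 + 2 * (S⁻¹ - s⁻¹) * S⁻¹ * 0 + S⁻¹ ^ 2 * q ^ 2
        = (s ^ 2 + q ^ 2) / S ^ 2 - 2 * (s / S) + 1 := by field_simp; ring
    rw [e2, ← hS2, div_self (by positivity), div_pow]
    linarith
  have hint : ∀ {f : α → ℝ}, Measurable f →
      Integrable (fun x => Complex.exp ((f x : ℂ) * Complex.I)) P := fun hf =>
    Integrable.of_bound (by fun_prop) 1 (ae_of_all _ fun x => by rw [Complex.norm_exp_ofReal_mul_I])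
  rw [← integral_sub (hint (by fun_prop)) (hint (by fun_prop))]
  calc _ ≤ ∫ x, |t| * |Y x| ∂P := by
        refine norm_integral_le_of_norm_le ((hY2.integrable one_le_two).abs.const_mul _)
          (ae_of_all _ fun x => ?_)
        refine (norm_exp_mul_I_sub_le _ _).trans (le_of_eq ?_)
        rw [← abs_mul, hY]
        congr 1; ring
    _ = |t| * ∫ x, |Y x| ∂P := integral_const_mul _ _
    _ ≤ |t| * (q / s) := by
        gcongr
        refine (integral_abs_le_sqrt P hY2).trans ?_
        exact (Real.sqrt_le_sqrt hYsq).trans (Real.sqrt_sq (by positivity)).le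

/-! ### Hoeffding decomposition of weighted rank statistics -/

/-- `∑_{j < i} w i 1(x i < x j)`. -/
def rankSum {n : ℕ} (w : Fin n → ℝ) (x : Fin n → ℝ) : ℝ :=
  ∑ i : Fin n, ∑ j : Fin n, if j < i ∧ x i < x j then w i else 0

/-- The contribution of coordinate `k` to the Hájek projection of `rankSum w`, up to a constant. -/
def hajek {n : ℕ} (ν : Fin n → Measure ℝ) (w : Fin n → ℝ) (k : Fin n) (t : ℝ) : ℝ :=
  (∑ i : Fin n, if k < i then w i * (ν i).real (Set.Iio t) else 0)
    + ∑ j : Fin n, if j < k then w k * (ν j).real (Set.Ioi t) else 0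

/-- The doubly centred kernel of the pair `(i, j)`. -/
def degKernel {n : ℕ} (ν : Fin n → Measure ℝ) (i j : Fin n) (x : Fin n → ℝ) : ℝ :=
  (if x i < x j then 1 else 0) - (ν i).real (Set.Iio (x j)) - (ν j).real (Set.Ioi (x i))
    + ∫ y, (ν i).real (Set.Iio y) ∂(ν j)

/-- The degenerate part of `rankSum w`. -/
def degPart {n : ℕ} (ν : Fin n → Measure ℝ) (w : Fin n → ℝ) (x : Fin n → ℝ) : ℝ :=
  ∑ p ∈ Finset.univ.filter (fun p : Fin n × Fin n => p.2 < p.1), w p.1 * degKernel ν p.1 p.2 x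

lemma degKernel_update {n : ℕ} (ν : Fin n → Measure ℝ) {i j m : Fin n} (hi : m ≠ i)
    (hj : m ≠ j) (x : Fin n → ℝ) (y : ℝ) :
    degKernel ν i j (Function.update x m y) = degKernel ν i j x := by
  simp [degKernel, Function.update_of_ne hi.symm, Function.update_of_ne hj.symm]

/-- The pair `j < i` contributes its conditional probability given `x j` to coordinate `j` and the
one given `x i` to coordinate `i`; exchanging the order of summation collects these by coordinate
into `hajek`. -/
lemma rankSum_eq {n : ℕ} (ν : Fin n → Measure ℝ) (w : Fin n → ℝ) (x : Fin n → ℝ) :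
    rankSum w x = degPart ν w x + ∑ k, hajek ν w k (x k)
      - ∑ p ∈ Finset.univ.filter (fun p : Fin n × Fin n => p.2 < p.1),
          w p.1 * ∫ y, (ν p.1).real (Set.Iio y) ∂(ν p.2) := by
  have e1 : ∑ k, hajek ν w k (x k)
      = ∑ i : Fin n, ∑ j : Fin n, if j < i then
          w i * ((ν i).real (Set.Iio (x j)) + (ν j).real (Set.Ioi (x i))) else 0 := by
    simp only [hajek]
    rw [Finset.sum_add_distrib, Finset.sum_comm, ← Finset.sum_add_distrib]
    refine Finset.sum_congr rfl fun i _ => ?_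
    rw [← Finset.sum_add_distrib]
    refine Finset.sum_congr rfl fun j _ => ?_
    split_ifs <;> ring
  rw [e1, degPart, Finset.sum_filter, Finset.sum_filter, Fintype.sum_prod_type,
    Fintype.sum_prod_type, rankSum, ← Finset.sum_add_distrib, ← Finset.sum_sub_distrib]
  refine Finset.sum_congr rfl fun i _ => ?_
  rw [← Finset.sum_add_distrib, ← Finset.sum_sub_distrib]
  refine Finset.sum_congr rfl fun j _ => ?_
  unfold degKernel
  by_cases h : j < i <;> by_cases h' : x i < x j <;> simp [h, h'] <;> ring

lemma measurable_real_Iio (ν : Measure ℝ) [IsFiniteMeasure ν] :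
    Measurable fun t => ν.real (Set.Iio t) :=
  Monotone.measurable fun _ _ h => measureReal_mono (Set.Iio_subset_Iio h)

lemma measurable_real_Ioi (ν : Measure ℝ) [IsFiniteMeasure ν] :
    Measurable fun t => ν.real (Set.Ioi t) :=
  Antitone.measurable fun _ _ h => measureReal_mono (Set.Ioi_subset_Ioi h)

section

variable {n : ℕ} (ν : Fin n → Measure ℝ) [∀ i, IsProbabilityMeasure (ν i)] (w : Fin n → ℝ)

lemma measurable_hajek (k : Fin n) : Measurable (hajek ν w k) := by
  have h1 := fun i => measurable_real_Iio (ν i)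
  have h2 := fun i => measurable_real_Ioi (ν i)
  refine Measurable.add ?_ ?_ <;> refine Finset.measurable_sum _ fun i _ => ?_ <;> split_ifs <;>
    fun_prop

lemma measurable_degKernel (i j : Fin n) : Measurable (degKernel ν i j) := by
  have h1 : Measurable fun x : Fin n → ℝ => (ν i).real (Set.Iio (x j)) :=
    (measurable_real_Iio (ν i)).comp (measurable_pi_apply j)
  have h2 : Measurable fun x : Fin n → ℝ => (ν j).real (Set.Ioi (x i)) :=
    (measurable_real_Ioi (ν j)).comp (measurable_pi_apply i)
  have h3 : Measurable fun x : Fin n → ℝ => if x i < x j then (1 : ℝ) else 0 :=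
    Measurable.ite (measurableSet_lt (measurable_pi_apply i) (measurable_pi_apply j))
      measurable_const measurable_const
  exact ((h3.sub h1).sub h2).add_const _

lemma measurable_degPart : Measurable (degPart ν w) :=
  Finset.measurable_sum _ fun p _ => (measurable_degKernel ν p.1 p.2).const_mul _

lemma measurable_rankSum : Measurable (rankSum w) := by
  refine Finset.measurable_sum _ fun i _ => Finset.measurable_sum _ fun j _ => ?_
  refine Measurable.ite ?_ measurable_const measurable_const
  refine MeasurableSet.inter (MeasurableSet.const _) ?_
  exact measurableSet_lt (measurable_pi_apply i) (measurable_pi_apply j)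

lemma abs_degKernel_le (i j : Fin n) (x : Fin n → ℝ) : |degKernel ν i j x| ≤ 2 := by
  have h1 : 0 ≤ (ν i).real (Set.Iio (x j)) := measureReal_nonneg
  have h2 : (ν i).real (Set.Iio (x j)) ≤ 1 := measureReal_le_one
  have h3 : 0 ≤ (ν j).real (Set.Ioi (x i)) := measureReal_nonneg
  have h4 : (ν j).real (Set.Ioi (x i)) ≤ 1 := measureReal_le_one
  have h5 : 0 ≤ ∫ y, (ν i).real (Set.Iio y) ∂(ν j) := integral_nonneg fun _ => measureReal_nonneg
  have h6 : ∫ y, (ν i).real (Set.Iio y) ∂(ν j) ≤ 1 := by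
    refine (integral_mono (integrable_of_bounded (measurable_real_Iio _) (C := 1) fun x => ?_)
      (integrable_const 1) fun x => measureReal_le_one).trans (by simp)
    rw [abs_of_nonneg measureReal_nonneg]; exact measureReal_le_one
  unfold degKernel
  rw [abs_le]
  split_ifs <;> constructor <;> linarith

/-- Both sides are the probability that the first of two independent variables is the smaller. It
lets the single constant in `degKernel` centre the kernel in either coordinate. -/
lemma integral_Iio_eq_integral_Ioi (α β : Measure ℝ) [IsProbabilityMeasure α]
    [IsProbabilityMeasure β] :
    ∫ y, α.real (Set.Iio y) ∂β = ∫ y, β.real (Set.Ioi y) ∂α := by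
  have hs : MeasurableSet {p : ℝ × ℝ | p.1 < p.2} := measurableSet_lt measurable_fst measurable_snd
  have hi : Integrable (fun p : ℝ × ℝ => Set.indicator {p : ℝ × ℝ | p.1 < p.2} (fun _ => (1 : ℝ)) p)
      (α.prod β) := (integrable_const _).indicator hs
  have h := integral_integral_swap (f := fun x y =>
    Set.indicator {p : ℝ × ℝ | p.1 < p.2} (fun _ => (1 : ℝ)) (x, y)) hi
  have e1 : ∀ x, ∫ y, Set.indicator {p : ℝ × ℝ | p.1 < p.2} (fun _ => (1 : ℝ)) (x, y) ∂β
      = β.real (Set.Ioi x) := fun x => by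
    rw [← integral_indicator_one measurableSet_Ioi]; rfl
  have e2 : ∀ y, ∫ x, Set.indicator {p : ℝ × ℝ | p.1 < p.2} (fun _ => (1 : ℝ)) (x, y) ∂α
      = α.real (Set.Iio y) := fun y => by
    rw [← integral_indicator_one measurableSet_Iio]; rfl
  simp_rw [e1, e2] at h
  exact h.symm

lemma integral_degKernel_update_left {i j : Fin n} (hij : i ≠ j) (x : Fin n → ℝ) :
    ∫ y, degKernel ν i j (Function.update x i y) ∂(ν i) = 0 := by
  have e : ∀ y, degKernel ν i j (Function.update x i y)
      = (Set.Iio (x j)).indicator 1 y - (ν i).real (Set.Iio (x j)) - (ν j).real (Set.Ioi y)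
        + ∫ y, (ν i).real (Set.Iio y) ∂(ν j) := by
    intro y
    simp [degKernel, Function.update_of_ne hij.symm, Set.indicator_apply]
  have i1 : Integrable ((Set.Iio (x j)).indicator (1 : ℝ → ℝ)) (ν i) :=
    (integrable_const _).indicator measurableSet_Iio
  have i2 : Integrable (fun y => (ν j).real (Set.Ioi y)) (ν i) :=
    integrable_of_bounded (measurable_real_Ioi _) (C := 1) fun x => by
      rw [abs_of_nonneg measureReal_nonneg]; exact measureReal_le_one
  have i3 : Integrable (fun y => (Set.Iio (x j)).indicator (1 : ℝ → ℝ) y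
      - (ν i).real (Set.Iio (x j))) (ν i) := i1.sub (integrable_const _)
  have i4 : Integrable (fun y => (Set.Iio (x j)).indicator (1 : ℝ → ℝ) y
      - (ν i).real (Set.Iio (x j)) - (ν j).real (Set.Ioi y)) (ν i) := i3.sub i2
  simp_rw [e]
  rw [integral_add i4 (integrable_const _), integral_sub i3 i2,
    integral_sub i1 (integrable_const _), integral_indicator_one measurableSet_Iio,
    integral_Iio_eq_integral_Ioi (ν i) (ν j)]
  simp

lemma integral_degKernel_update_right {i j : Fin n} (hij : i ≠ j) (x : Fin n → ℝ) :
    ∫ y, degKernel ν i j (Function.update x j y) ∂(ν j) = 0 := by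
  have e : ∀ y, degKernel ν i j (Function.update x j y)
      = (Set.Ioi (x i)).indicator 1 y - (ν i).real (Set.Iio y) - (ν j).real (Set.Ioi (x i))
        + ∫ y, (ν i).real (Set.Iio y) ∂(ν j) := by
    intro y
    simp [degKernel, Function.update_of_ne hij, Set.indicator_apply]
  have i1 : Integrable ((Set.Ioi (x i)).indicator (1 : ℝ → ℝ)) (ν j) :=
    (integrable_const _).indicator measurableSet_Ioi
  have i2 : Integrable (fun y => (ν i).real (Set.Iio y)) (ν j) :=
    integrable_of_bounded (measurable_real_Iio _) (C := 1) fun x => by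
      rw [abs_of_nonneg measureReal_nonneg]; exact measureReal_le_one
  have i3 : Integrable (fun y => (Set.Ioi (x i)).indicator (1 : ℝ → ℝ) y
      - (ν i).real (Set.Iio y)) (ν j) := i1.sub i2
  have i4 : Integrable (fun y => (Set.Ioi (x i)).indicator (1 : ℝ → ℝ) y
      - (ν i).real (Set.Iio y) - (ν j).real (Set.Ioi (x i))) (ν j) := i3.sub (integrable_const _)
  simp_rw [e]
  rw [integral_add i4 (integrable_const _), integral_sub i3 (integrable_const _), integral_sub i1 i2,
    integral_indicator_one measurableSet_Ioi]
  simp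

/-- The kernel is centred in each of its two coordinates, so integrating first over one that `u`
ignores gives zero. The orthogonality relations involving the kernels all come from this. -/
lemma integral_mul_degKernel_eq_zero {i j m : Fin n} (hij : i ≠ j) (hm : m = i ∨ m = j)
    {u : (Fin n → ℝ) → ℝ} (hu : Measurable u) {C : ℝ} (hC : ∀ x, |u x| ≤ C)
    (hum : ∀ x y, u (Function.update x m y) = u x) :
    ∫ x, u x * degKernel ν i j x ∂(Measure.pi ν) = 0 := by
  refine integral_mul_eq_zero_of_update ν m ?_ hum ?_
  · refine integrable_of_bounded (hu.mul (measurable_degKernel ν i j)) (C := C * 2) fun x => ?_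
    rw [abs_mul]
    exact mul_le_mul (hC x) (abs_degKernel_le ν i j x) (abs_nonneg _)
      ((abs_nonneg _).trans (hC x))
  · rcases hm with rfl | rfl
    · exact integral_degKernel_update_left ν hij
    · exact integral_degKernel_update_right ν hij

lemma integral_degKernel {i j : Fin n} (hij : i ≠ j) :
    ∫ x, degKernel ν i j x ∂(Measure.pi ν) = 0 := by
  have h := integral_mul_degKernel_eq_zero ν hij (Or.inl rfl) (u := fun _ => 1) measurable_const
    (C := 1) (fun _ => by simp) (fun _ _ => rfl)
  simpa using h

lemma integral_degKernel_mul_degKernel {p q : Fin n × Fin n} (hp : p.2 < p.1) (hq : q.2 < q.1)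
    (hpq : p ≠ q) :
    ∫ x, degKernel ν p.1 p.2 x * degKernel ν q.1 q.2 x ∂(Measure.pi ν) = 0 := by
  -- Two pairs with the same underlying set, both listed with the larger index first, coincide; so
  -- distinct pairs leave a coordinate of `q` outside `p`.
  obtain ⟨m, hm, h1, h2⟩ : ∃ m, (m = q.1 ∨ m = q.2) ∧ m ≠ p.1 ∧ m ≠ p.2 := by
    by_contra! h
    have ha := h q.1 (Or.inl rfl)
    have hb := h q.2 (Or.inr rfl)
    apply hpq
    by_cases h1 : q.1 = p.1
    · by_cases h2 : q.2 = p.1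
      · exact absurd (h1.trans h2.symm) hq.ne'
      · exact Prod.ext h1.symm (hb h2).symm
    · have h3 := ha h1
      by_cases h2 : q.2 = p.1
      · rw [h2, h3] at hq; exact absurd hq (not_lt.2 hp.le)
      · exact absurd (h3.trans (hb h2).symm) hq.ne'
  exact integral_mul_degKernel_eq_zero ν hq.ne' hm (measurable_degKernel ν p.1 p.2)
    (abs_degKernel_le ν p.1 p.2) (degKernel_update ν h1 h2)

lemma integral_sq_sum_of_orthogonal {α κ : Type*} [MeasurableSpace α] (P : Measure α)
    [IsFiniteMeasure P] (s : Finset κ) {f : κ → α → ℝ} (hf : ∀ a, MemLp (f a) 2 P)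
    (ho : ∀ a ∈ s, ∀ b ∈ s, a ≠ b → ∫ x, f a x * f b x ∂P = 0) :
    ∫ x, (∑ a ∈ s, f a x) ^ 2 ∂P = ∑ a ∈ s, ∫ x, f a x ^ 2 ∂P := by
  have hi : ∀ a b, Integrable (fun x => f a x * f b x) P := fun a b => (hf a).integrable_mul (hf b)
  simp_rw [sq, Finset.sum_mul_sum]
  rw [integral_finsetSum _ fun a _ => integrable_finsetSum _ fun b _ => hi a b]
  refine Finset.sum_congr rfl fun a ha => ?_
  rw [integral_finsetSum _ fun b _ => hi a b]
  exact Finset.sum_eq_single_of_mem a ha fun b hb hba => ho a ha b hb hba.symm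

end

/-! ### Admissible weights and the size of the two parts of the decomposition -/

lemma sum_fin_div_le (n : ℕ) :
    ∑ i : Fin n, (n : ℝ) / ((i : ℕ) : ℝ) ≤ n * (1 + Real.log n) := by
  simp_rw [div_eq_mul_inv]
  rw [← Finset.mul_sum, Fin.sum_univ_eq_sum_range (fun i => ((i : ℕ) : ℝ)⁻¹) n]
  refine mul_le_mul_of_nonneg_left ?_ (Nat.cast_nonneg n)
  cases n with
  | zero => simp
  | succ m =>
    -- The term of index `0` is split off; it vanishes because `0⁻¹ = 0`, and a harmonic sum
    -- remains.
    rw [Finset.sum_range_succ']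
    have h := harmonic_le_one_add_log m
    rw [harmonic] at h
    push_cast at h
    rw [Nat.cast_zero, inv_zero, add_zero]
    push_cast
    refine h.trans ?_
    rcases Nat.eq_zero_or_pos m with rfl | hm
    · simp
    · have h0 : (0 : ℝ) < m := by exact_mod_cast hm
      gcongr
      linarith

/-- The weights covered by the limit theorem: `1 ≤ w i ≤ n / i`. -/
def AdmissibleWeight {n : ℕ} (w : Fin n → ℝ) : Prop :=
  ∀ i : Fin n, 0 < (i : ℕ) → 1 ≤ w i ∧ w i ≤ (n : ℝ) / ((i : ℕ) : ℝ)

lemma AdmissibleWeight.nonneg {n : ℕ} {w : Fin n → ℝ} (hw : AdmissibleWeight w)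
    {i j : Fin n} (h : j < i) : 0 ≤ w i :=
  zero_le_one.trans (hw i ((Nat.zero_le _).trans_lt h)).1

lemma AdmissibleWeight.le {n : ℕ} {w : Fin n → ℝ} (hw : AdmissibleWeight w) {i j : Fin n} (h : j < i) :
    w i ≤ (n : ℝ) / ((i : ℕ) : ℝ) :=
  (hw i ((Nat.zero_le _).trans_lt h)).2

/-- There are exactly `k` indices below `k`, which cancels the denominator in `w k ≤ n / k`. -/
lemma AdmissibleWeight.sum_le {n : ℕ} {w : Fin n → ℝ} (hw : AdmissibleWeight w) (k : Fin n) :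
    ∑ j : Fin n, (if j < k then w k else 0) ≤ n := by
  rw [← Finset.sum_filter, Finset.sum_const, nsmul_eq_mul]
  have hc : (Finset.univ.filter (fun j : Fin n => j < k)).card = (k : ℕ) := by
    rw [Finset.filter_gt_eq_Iio, Fin.card_Iio]
  rw [hc]
  rcases Nat.eq_zero_or_pos (k : ℕ) with h | h
  · simp [h]
  · have h2 := (hw k h).2
    have h' : (0 : ℝ) < (k : ℕ) := by exact_mod_cast h
    rw [le_div_iff₀ h'] at h2
    linarith

lemma hajek_nonneg {n : ℕ} (ν : Fin n → Measure ℝ) {w : Fin n → ℝ} (hw : AdmissibleWeight w)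
    (k : Fin n) (t : ℝ) : 0 ≤ hajek ν w k t := by
  refine add_nonneg (Finset.sum_nonneg fun i _ => ?_) (Finset.sum_nonneg fun i _ => ?_) <;>
    split_ifs with h
  · exact mul_nonneg (hw.nonneg h) measureReal_nonneg
  · exact le_rfl
  · exact mul_nonneg (hw.nonneg h) measureReal_nonneg
  · exact le_rfl

section

variable {n : ℕ} (ν : Fin n → Measure ℝ) [∀ i, IsProbabilityMeasure (ν i)] {w : Fin n → ℝ}

lemma hajek_le (hw : AdmissibleWeight w) (k : Fin n) (t : ℝ) :
    hajek ν w k t ≤ n * (2 + Real.log n) := by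
  have h1 : ∑ i : Fin n, (if k < i then w i * (ν i).real (Set.Iio t) else 0)
      ≤ n * (1 + Real.log n) := by
    refine (Finset.sum_le_sum fun i _ => ?_).trans (sum_fin_div_le n)
    split_ifs with h
    · exact (mul_le_of_le_one_right (hw.nonneg h) measureReal_le_one).trans (hw.le h)
    · positivity
  have h2 : ∑ j : Fin n, (if j < k then w k * (ν j).real (Set.Ioi t) else 0) ≤ n := by
    refine (Finset.sum_le_sum fun j _ => ?_).trans (hw.sum_le k)
    split_ifs with h
    · exact mul_le_of_le_one_right (hw.nonneg h) measureReal_le_one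
    · exact le_rfl
  unfold hajek
  linarith

lemma abs_hajek_sub_le (hw : AdmissibleWeight w) (k : Fin n) (t : ℝ) :
    |hajek ν w k t - ∫ y, hajek ν w k y ∂(ν k)| ≤ n * (2 + Real.log n) := by
  have h1 := hajek_nonneg ν hw k
  have h2 := hajek_le ν hw k
  have h3 : 0 ≤ ∫ y, hajek ν w k y ∂(ν k) := integral_nonneg h1
  have h4 : ∫ y, hajek ν w k y ∂(ν k) ≤ n * (2 + Real.log n) := by
    refine (integral_mono (integrable_of_bounded (measurable_hajek ν w k)
      (C := n * (2 + Real.log n)) fun x => ?_) (integrable_const _) h2).trans (by simp)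
    rw [abs_of_nonneg (h1 x)]; exact h2 x
  rw [abs_le]
  constructor <;> linarith [h1 t, h2 t]

/-- By orthogonality only the diagonal terms survive, each at most `4 (w i)²`. For fixed `i`, one
factor `w i` summed over `j < i` gives at most `n`; the other is summed over `i` and gives the
logarithm. -/
lemma integral_degPart_sq_le (hw : AdmissibleWeight w) :
    ∫ x, degPart ν w x ^ 2 ∂(Measure.pi ν) ≤ (2 * (n * (2 + Real.log n))) ^ 2 := by
  have hlog := Real.log_natCast_nonneg n
  have hL2 : ∀ p : Fin n × Fin n, MemLp (fun x => w p.1 * degKernel ν p.1 p.2 x) 2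
      (Measure.pi ν) := fun p =>
    (MemLp.of_bound (measurable_degKernel ν p.1 p.2).aestronglyMeasurable 2
      (ae_of_all _ (abs_degKernel_le ν p.1 p.2))).const_mul _
  unfold degPart
  rw [integral_sq_sum_of_orthogonal (Measure.pi ν) _ hL2]
  · calc _ ≤ ∑ p ∈ Finset.univ.filter (fun p : Fin n × Fin n => p.2 < p.1), 4 * w p.1 ^ 2 := by
          refine Finset.sum_le_sum fun p _ => ?_
          refine (integral_mono (hL2 p).integrable_sq
            (integrable_const (4 * w p.1 ^ 2)) fun x => ?_).trans (by simp)
          have h1 : degKernel ν p.1 p.2 x ^ 2 ≤ 2 ^ 2 := sq_le_sq' (abs_le.1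
            (abs_degKernel_le ν p.1 p.2 x)).1 (abs_le.1 (abs_degKernel_le ν p.1 p.2 x)).2
          change (w p.1 * degKernel ν p.1 p.2 x) ^ 2 ≤ _
          rw [mul_pow]
          nlinarith [sq_nonneg (w p.1)]
      _ ≤ ∑ i : Fin n, 4 * n * ((n : ℝ) / ((i : ℕ) : ℝ)) := by
          rw [Finset.sum_filter, Fintype.sum_prod_type]
          refine Finset.sum_le_sum fun i _ => ?_
          rcases Nat.eq_zero_or_pos (i : ℕ) with h | h
          · refine (Finset.sum_nonpos fun j _ => ?_).trans (by positivity)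
            have : ¬ j < i := fun hj => by
              have : (j : ℕ) < i := hj
              omega
            simp [this]
          · have e : ∀ j : Fin n, (if j < i then 4 * w i ^ 2 else 0)
                = 4 * w i * (if j < i then w i else 0) := fun j => by split_ifs <;> ring
            simp only [e]
            rw [← Finset.mul_sum]
            have h1 := hw.sum_le i
            have h2 := hw i h
            calc 4 * w i * ∑ j : Fin n, (if j < i then w i else 0) ≤ 4 * w i * n := by
                  have : 0 ≤ w i := by linarith
                  gcongr
              _ ≤ 4 * ((n : ℝ) / ((i : ℕ) : ℝ)) * n := by gcongr; exact h2.2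
              _ = _ := by ring
      _ ≤ 4 * n * (n * (1 + Real.log n)) := by
          rw [← Finset.mul_sum]
          gcongr
          exact sum_fin_div_le n
      -- The logarithm is replaced by a larger square, so that one bound of order `n log n` controls
      -- both the degenerate part and the single summands.
      _ ≤ _ := by
          have : 4 * (n : ℝ) * (n * (1 + Real.log n)) = 4 * n ^ 2 * (1 + Real.log n) := by ring
          have h2 : (2 * (n * (2 + Real.log n))) ^ 2 = 4 * (n : ℝ) ^ 2 * (2 + Real.log n) ^ 2 := by
            ring
          rw [this, h2]
          gcongr
          nlinarith
  · intro p hp q hq hpq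
    have h := integral_degKernel_mul_degKernel ν (Finset.mem_filter.1 hp).2
      (Finset.mem_filter.1 hq).2 hpq
    have e : ∀ x, w p.1 * degKernel ν p.1 p.2 x * (w q.1 * degKernel ν q.1 q.2 x)
        = w p.1 * w q.1 * (degKernel ν p.1 p.2 x * degKernel ν q.1 q.2 x) := fun x => by ring
    simp_rw [e]
    rw [integral_const_mul, h, mul_zero]

/-- Quantitative asymptotic normality of a weighted rank statistic of independent observations. -/
lemma norm_integral_exp_rankSum_sub_le (hw : AdmissibleWeight w) {s B : ℝ} (hs : 0 < s)
    (hB : B = 2 * (n * (2 + Real.log n)))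
    (hsum : ∑ k, Var[hajek ν w k; ν k] = s ^ 2) (t : ℝ) (ht : |t| * B / s ≤ 1) :
    ‖∫ x, Complex.exp (((t * (rankSum w x - ∫ y, rankSum w y ∂(Measure.pi ν))
          / √(Var[rankSum w; Measure.pi ν]) : ℝ) : ℂ) * Complex.I) ∂(Measure.pi ν)
        - Complex.exp (-((t : ℂ) ^ 2 / 2))‖ ≤ 4 * (|t| * B / s) * t ^ 2 + |t| * (B / s) := by
  have hlog := Real.log_natCast_nonneg n
  have hB0 : 0 ≤ n * (2 + Real.log n) := by positivity
  set g : Fin n → ℝ → ℝ := fun k y => hajek ν w k y - ∫ z, hajek ν w k z ∂(ν k) with hg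
  have hgm : ∀ k, Measurable (g k) := fun k => (measurable_hajek ν w k).sub_const _
  have hgb : ∀ k y, |g k y| ≤ n * (2 + Real.log n) := abs_hajek_sub_le ν hw
  have hgB : ∀ k y, |g k y| ≤ B := fun k y => (hgb k y).trans (by linarith)
  have hhi : ∀ k, Integrable (hajek ν w k) (ν k) := fun k =>
    integrable_of_bounded (measurable_hajek ν w k) (C := n * (2 + Real.log n)) fun y => by
      rw [abs_of_nonneg (hajek_nonneg ν hw k y)]; exact hajek_le ν hw k y
  have hg0 : ∀ k, ∫ y, g k y ∂(ν k) = 0 := fun k => by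
    rw [hg]; simp [integral_sub (hhi k) (integrable_const _)]
  have hgsq : ∑ k, ∫ y, g k y ^ 2 ∂(ν k) = s ^ 2 := by
    rw [← hsum]
    refine Finset.sum_congr rfl fun k _ => ?_
    rw [variance_eq_integral (measurable_hajek ν w k).aemeasurable]
  set H : (Fin n → ℝ) → ℝ := fun x => ∑ k, g k (x k) with hH
  have hHm : Measurable H := Finset.measurable_sum _ fun k _ =>
    (hgm k).comp (measurable_pi_apply k)
  have hHb : ∀ x, |H x| ≤ n * B := fun x => by
    refine (Finset.abs_sum_le_sum_abs _ _).trans ((Finset.sum_le_sum fun k _ => hgB k (x k)).trans ?_)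
    simp
  have hDb : ∀ x, |degPart ν w x| ≤
      ∑ p ∈ Finset.univ.filter (fun p : Fin n × Fin n => p.2 < p.1), |w p.1| * 2 := fun x => by
    refine (Finset.abs_sum_le_sum_abs _ _).trans (Finset.sum_le_sum fun p _ => ?_)
    rw [abs_mul]
    gcongr
    exact abs_degKernel_le ν p.1 p.2 x
  set CD := ∑ p ∈ Finset.univ.filter (fun p : Fin n × Fin n => p.2 < p.1), |w p.1| * 2
  have hDi : Integrable (degPart ν w) (Measure.pi ν) :=
    integrable_of_bounded (measurable_degPart ν w) hDb
  have hHi : Integrable H (Measure.pi ν) := integrable_of_bounded hHm hHb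
  have hgi : ∀ k, Integrable (fun x : Fin n → ℝ => g k (x k)) (Measure.pi ν) := fun k =>
    integrable_of_bounded ((hgm k).comp (measurable_pi_apply k)) fun x => hgB k (x k)
  have hD0 : ∫ x, degPart ν w x ∂(Measure.pi ν) = 0 := by
    unfold degPart
    rw [integral_finsetSum _ fun p _ => (integrable_of_bounded (measurable_degKernel ν p.1 p.2)
      (abs_degKernel_le ν p.1 p.2)).const_mul _]
    refine Finset.sum_eq_zero fun p hp => ?_
    rw [integral_const_mul, integral_degKernel ν (Finset.mem_filter.1 hp).2.ne', mul_zero]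
  have hH0 : ∫ x, H x ∂(Measure.pi ν) = 0 := by
    rw [hH, integral_finsetSum _ fun k _ => hgi k]
    refine Finset.sum_eq_zero fun k _ => ?_
    rw [integral_pi_apply ν k (hgm k), hg0]
  have hHsq : ∫ x, H x ^ 2 ∂(Measure.pi ν) = s ^ 2 := by
    rw [← hgsq, hH, integral_sq_sum_of_orthogonal (Measure.pi ν) Finset.univ
      (f := fun k (x : Fin n → ℝ) => g k (x k))]
    · refine Finset.sum_congr rfl fun k _ => ?_
      exact integral_pi_apply ν k ((hgm k).pow_const 2)
    · exact fun k => MemLp.of_bound ((hgm k).comp (measurable_pi_apply k)).aestronglyMeasurable B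
        (ae_of_all _ fun x => hgB k (x k))
    · intro a _ b _ hab
      refine integral_mul_eq_zero_of_update ν b (u := fun x => g a (x a)) (f := fun x => g b (x b))
        ?_ (fun x y => by simp [Function.update_of_ne hab]) (fun x => by simpa using hg0 b)
      refine integrable_of_bounded (C := B * B) (((hgm a).comp (measurable_pi_apply a)).mul
        ((hgm b).comp (measurable_pi_apply b))) fun x => ?_
      rw [abs_mul]
      exact mul_le_mul (hgB a _) (hgB b _) (abs_nonneg _) ((abs_nonneg _).trans (hgB a (x a)))
  have hHD : ∫ x, H x * degPart ν w x ∂(Measure.pi ν) = 0 := by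
    have e : ∀ x, H x * degPart ν w x
        = ∑ k, ∑ p ∈ Finset.univ.filter (fun p : Fin n × Fin n => p.2 < p.1),
          w p.1 * (g k (x k) * degKernel ν p.1 p.2 x) := fun x => by
      rw [hH, degPart, Finset.sum_mul_sum]
      refine Finset.sum_congr rfl fun k _ => Finset.sum_congr rfl fun p _ => by ring
    have hi : ∀ (k : Fin n) (p : Fin n × Fin n),
        Integrable (fun x => w p.1 * (g k (x k) * degKernel ν p.1 p.2 x)) (Measure.pi ν) := by
      intro k p
      refine Integrable.const_mul ?_ _
      refine integrable_of_bounded (C := B * 2) (((hgm k).comp (measurable_pi_apply k)).mul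
        (measurable_degKernel ν p.1 p.2)) fun x => ?_
      rw [abs_mul]
      exact mul_le_mul (hgB k _) (abs_degKernel_le ν _ _ _) (abs_nonneg _)
        ((abs_nonneg _).trans (hgB k (x k)))
    simp_rw [e]
    rw [integral_finsetSum _ fun k _ => integrable_finsetSum _ fun p _ => hi k p]
    refine Finset.sum_eq_zero fun k _ => ?_
    rw [integral_finsetSum _ fun p _ => hi k p]
    refine Finset.sum_eq_zero fun p hp => ?_
    have hp' := (Finset.mem_filter.1 hp).2
    -- A pair has two distinct coordinates, so at least one of them differs from `k`.
    obtain ⟨m, hm, hmk⟩ : ∃ m, (m = p.1 ∨ m = p.2) ∧ m ≠ k := by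
      by_cases h : p.1 = k
      · exact ⟨p.2, Or.inr rfl, fun h2 => hp'.ne (h2.trans h.symm)⟩
      · exact ⟨p.1, Or.inl rfl, h⟩
    rw [integral_const_mul, integral_mul_degKernel_eq_zero ν hp'.ne' hm (u := fun x => g k (x k))
      ((hgm k).comp (measurable_pi_apply k)) (fun x => hgB k (x k))
      (fun x y => by simp [Function.update_of_ne hmk.symm]), mul_zero]
  set q := √(∫ x, degPart ν w x ^ 2 ∂(Measure.pi ν)) with hq
  have hDsq : ∫ x, degPart ν w x ^ 2 ∂(Measure.pi ν) = q ^ 2 :=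
    (Real.sq_sqrt (integral_nonneg fun x => sq_nonneg _)).symm
  have hqB : q ≤ B := by
    rw [hq, hB]
    exact (Real.sqrt_le_sqrt (integral_degPart_sq_le ν hw)).trans
      (Real.sqrt_sq (by positivity)).le
  have hK : ∀ x, rankSum w x - ∫ y, rankSum w y ∂(Measure.pi ν) = H x + degPart ν w x := by
    have h1 : ∃ c, ∀ x, rankSum w x = H x + degPart ν w x + c := by
      refine ⟨(∑ k, ∫ z, hajek ν w k z ∂(ν k))
        - ∑ p ∈ Finset.univ.filter (fun p : Fin n × Fin n => p.2 < p.1),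
          w p.1 * ∫ y, (ν p.1).real (Set.Iio y) ∂(ν p.2), fun x => ?_⟩
      rw [rankSum_eq ν w x, hH, hg]
      simp only [Finset.sum_sub_distrib]
      ring
    obtain ⟨c, hc⟩ := h1
    have hm : ∫ y, rankSum w y ∂(Measure.pi ν) = c := by
      simp_rw [hc]
      rw [integral_add (f := fun y => H y + degPart ν w y) (hHi.add hDi) (integrable_const _),
        integral_add hHi hDi, hH0, hD0]
      simp
    intro x
    rw [hm, hc]; ring
  have hvar : Var[rankSum w; Measure.pi ν] = s ^ 2 + q ^ 2 := by
    rw [variance_eq_integral (measurable_rankSum w).aemeasurable]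
    simp_rw [hK]
    have hH2 : MemLp H 2 (Measure.pi ν) :=
      MemLp.of_bound hHm.aestronglyMeasurable _ (ae_of_all _ hHb)
    have hD2 : MemLp (degPart ν w) 2 (Measure.pi ν) :=
      MemLp.of_bound (measurable_degPart ν w).aestronglyMeasurable _ (ae_of_all _ hDb)
    have e : ∀ x, (H x + degPart ν w x) ^ 2
        = H x ^ 2 + 2 * (H x * degPart ν w x) + degPart ν w x ^ 2 := fun x => by ring
    have i2 : Integrable (fun x => 2 * (H x * degPart ν w x)) (Measure.pi ν) :=
      (hH2.integrable_mul hD2).const_mul _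
    have i12 : Integrable (fun x => H x ^ 2 + 2 * (H x * degPart ν w x)) (Measure.pi ν) :=
      hH2.integrable_sq.add i2
    simp_rw [e]
    rw [integral_add i12 hD2.integrable_sq, integral_add hH2.integrable_sq i2, integral_const_mul,
      hHsq, hHD, hDsq]
    ring
  rw [hvar]
  simp_rw [hK]
  have h1 := norm_integral_exp_perturb_le (Measure.pi ν) hHm (measurable_degPart ν w)
    (C := max (n * B) CD) (fun x => (hHb x).trans (le_max_left _ _))
    (fun x => (hDb x).trans (le_max_right _ _)) hs (Real.sqrt_nonneg _) hHsq hDsq hHD t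
  have h2 := norm_integral_exp_sum_sub_le ν hgm hgB hg0 hs hgsq t ht
  have h3 : |t| * (q / s) ≤ |t| * (B / s) := by gcongr
  refine (norm_sub_le_norm_sub_add_norm_sub _
    (∫ x, Complex.exp (((t * H x / s : ℝ) : ℂ) * Complex.I) ∂(Measure.pi ν)) _).trans ?_
  linarith

end

/-! ### Lower bounds for the variance of the Hájek projection -/

/-- Wherever the mean lies relative to the midpoint `A + δ / 2`, `h` is at least `δ / 2` away from
it on one of the two half-lines, and Chebyshev's inequality applies there. The product of the two
probabilities is below either one, so both cases share a bound. -/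
lemma sq_mul_le_variance (ν : Measure ℝ) [IsProbabilityMeasure ν] {h : ℝ → ℝ} (hh : MemLp h 2 ν)
    {a b A δ : ℝ} (hδ : 0 < δ) (ha : ∀ x ≤ a, A + δ ≤ h x) (hb : ∀ x, b < x → h x ≤ A) :
    δ ^ 2 / 4 * (ν.real (Set.Iic a) * ν.real (Set.Ioi b)) ≤ Var[h; ν] := by
  have key : ∀ s : Set ℝ, (∀ x ∈ s, δ / 2 ≤ |h x - ∫ y, h y ∂ν|) →
      δ ^ 2 / 4 * ν.real s ≤ Var[h; ν] := by
    intro s hs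
    have h1 := meas_ge_le_variance_div_sq hh (half_pos hδ)
    have h2 : ν.real s ≤ Var[h; ν] / (δ / 2) ^ 2 := by
      refine ENNReal.toReal_le_of_le_ofReal (by have := variance_nonneg h ν; positivity) ?_
      exact (measure_mono hs).trans h1
    rw [le_div_iff₀ (by positivity)] at h2
    calc _ = ν.real s * (δ / 2) ^ 2 := by ring
      _ ≤ _ := h2
  rcases le_total (∫ y, h y ∂ν) (A + δ / 2) with hm | hm
  · refine le_trans ?_ (key (Set.Iic a) fun x hx => ?_)
    · gcongr
      exact mul_le_of_le_one_right measureReal_nonneg measureReal_le_one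
    · have := ha x hx
      exact le_trans (by linarith) (le_abs_self _)
  · refine le_trans ?_ (key (Set.Ioi b) fun x hx => ?_)
    · gcongr
      exact mul_le_of_le_one_left measureReal_nonneg measureReal_le_one
    · have := hb x hx
      exact le_trans (by linarith) (neg_le_abs _)

/-- The closeness of `k` to `n` limits the increasing part of the projection to `2 (n - k) ≤ n r /
4`, while the decreasing part drops by at least `k r ≥ 7 n r / 8` between `a` and `b`. The net drop
exceeds `n r / 2`. -/
lemma le_variance_hajek {n : ℕ} (ν : Fin n → Measure ℝ) [∀ i, IsProbabilityMeasure (ν i)]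
    {w : Fin n → ℝ} (hw : AdmissibleWeight w) (k : Fin n) {a b r : ℝ} (hr : 0 < r) (hr1 : r ≤ 1)
    (hk : (n : ℝ) - (k : ℕ) ≤ n * r / 8)
    (hgap : ∀ j, j ≠ k → r ≤ (ν j).real (Set.Ioi a) - (ν j).real (Set.Ioi b)) :
    (n * r) ^ 2 / 16 * ((ν k).real (Set.Iic a) * (ν k).real (Set.Ioi b))
      ≤ Var[hajek ν w k; ν k] := by
  have hn : (0 : ℝ) < n := by exact_mod_cast k.pos
  have hnr : n * r ≤ n := mul_le_of_le_one_right hn.le hr1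
  have hk0 : (0 : ℝ) < (k : ℕ) := by linarith
  have hk0' : 0 < (k : ℕ) := by exact_mod_cast hk0
  have hwk := (hw k hk0').1
  have hlt : ∀ c : ℝ, ∑ j : Fin n, (if j < k then c else 0) = (k : ℕ) * c := fun c => by
    rw [← Finset.sum_filter, Finset.sum_const, nsmul_eq_mul, Finset.filter_gt_eq_Iio, Fin.card_Iio]
  have hW : ∑ i : Fin n, (if k < i then w i else 0) ≤ 2 * (n - (k : ℕ)) := by
    calc _ ≤ ∑ i : Fin n, (if k < i then (2 : ℝ) else 0) := by
          refine Finset.sum_le_sum fun i _ => ?_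
          split_ifs with h
          · refine (hw.le h).trans ?_
            -- Here `i > k ≥ n / 2`, so `n / i ≤ 2`.
            have hki : ((k : ℕ) : ℝ) ≤ (i : ℕ) := by exact_mod_cast (le_of_lt h : k ≤ i)
            rw [div_le_iff₀ (by linarith)]
            linarith
          · exact le_rfl
      _ ≤ _ := by
          rw [← Finset.sum_filter, Finset.sum_const, nsmul_eq_mul, Finset.filter_lt_eq_Ioi,
            Fin.card_Ioi, mul_comm]
          have h1 : ((n - 1 - (k : ℕ) : ℕ) : ℝ) ≤ ((n - (k : ℕ) : ℕ) : ℝ) := by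
            exact_mod_cast (by omega)
          rw [Nat.cast_sub k.isLt.le] at h1
          linarith
  have hmem : MemLp (hajek ν w k) 2 (ν k) :=
    MemLp.of_bound (measurable_hajek ν w k).aestronglyMeasurable (n * (2 + Real.log n))
      (ae_of_all _ fun x => by
        rw [Real.norm_eq_abs, abs_of_nonneg (hajek_nonneg ν hw k x)]; exact hajek_le ν hw k x)
  have hgs : (k : ℕ) * r ≤ (∑ j : Fin n, if j < k then w k * (ν j).real (Set.Ioi a) else 0)
      - ∑ j : Fin n, if j < k then w k * (ν j).real (Set.Ioi b) else 0 := by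
    rw [← hlt, ← Finset.sum_sub_distrib]
    refine Finset.sum_le_sum fun j _ => ?_
    split_ifs with h
    · have := hgap j h.ne
      rw [← mul_sub]
      nlinarith
    · simp
  have h := sq_mul_le_variance (ν k) hmem (a := a) (b := b)
    (A := (∑ i : Fin n, if k < i then w i else 0)
      + ∑ j : Fin n, if j < k then w k * (ν j).real (Set.Ioi b) else 0) (δ := n * r / 2)
    (by positivity) (fun x hx => ?_) (fun x hx => ?_)
  · refine le_trans (le_of_eq ?_) h
    ring
  · have h1 : (∑ j : Fin n, if j < k then w k * (ν j).real (Set.Ioi a) else 0)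
        ≤ hajek ν w k x := by
      unfold hajek
      refine le_add_of_nonneg_of_le (Finset.sum_nonneg fun i _ => ?_)
        (Finset.sum_le_sum fun j _ => ?_) <;> split_ifs with h
      · exact mul_nonneg (hw.nonneg h) measureReal_nonneg
      · exact le_rfl
      · exact mul_le_mul_of_nonneg_left (measureReal_mono (Set.Ioi_subset_Ioi hx)) (hw.nonneg h)
      · exact le_rfl
    have h2 : (n - n * r / 8) * r ≤ (k : ℕ) * r := by gcongr; linarith
    have h3 : n * r * r ≤ n * r * 1 := by gcongr
    nlinarith
  · unfold hajek
    refine add_le_add (Finset.sum_le_sum fun i _ => ?_) (Finset.sum_le_sum fun j _ => ?_) <;>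
      split_ifs with h
    · exact mul_le_of_le_one_right (hw.nonneg h) measureReal_le_one
    · exact le_rfl
    · exact mul_le_mul_of_nonneg_left (measureReal_mono (Set.Ioi_subset_Ioi hx.le)) (hw.nonneg h)
    · exact le_rfl

/-- The last `⌊y⌋` indices qualify, and `⌊y⌋ ≥ y / 2` because `y ≥ 1`. -/
lemma le_sum_of_le_last {n : ℕ} {f : Fin n → ℝ} (hf : ∀ k, 0 ≤ f k) {c y : ℝ} (hc : 0 ≤ c)
    (hy : 1 ≤ y) (hyn : y ≤ n) (h : ∀ k : Fin n, (n : ℝ) - (k : ℕ) ≤ y → c ≤ f k) :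
    y / 2 * c ≤ ∑ k, f k := by
  set m := ⌊y⌋₊ with hm
  have hm1 : 1 ≤ m := Nat.le_floor (by simpa using hy)
  have hmy : (m : ℝ) ≤ y := Nat.floor_le (by linarith)
  have hmn : m ≤ n := by exact_mod_cast hmy.trans hyn
  have hlt : y < m + 1 := Nat.lt_floor_add_one y
  have h1 : (1 : ℝ) ≤ m := by exact_mod_cast hm1
  set a : Fin n := ⟨n - m, by omega⟩ with ha
  calc y / 2 * c ≤ m * c := by gcongr; linarith
    _ = ∑ k ∈ Finset.Ici a, c := by
        rw [Finset.sum_const, Fin.card_Ici, nsmul_eq_mul, ha]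
        congr 2
        simp only
        omega
    _ ≤ ∑ k ∈ Finset.Ici a, f k := by
        refine Finset.sum_le_sum fun k hk => h k ?_
        have hk' : n - m ≤ (k : ℕ) := (Finset.mem_Ici.1 hk : a ≤ k)
        have : (n : ℝ) ≤ (k : ℕ) + m := by exact_mod_cast (by omega : n ≤ (k : ℕ) + m)
        linarith
    _ ≤ _ := Finset.sum_le_sum_of_subset_of_nonneg (Finset.subset_univ _) fun k _ _ => hf k

/-- A variable with a nontrivial upper tail has a nontrivial probability of not exceeding its
mean. -/
lemma sq_le_measureReal_le_mean {Ω : Type*} [MeasurableSpace Ω] (P : Measure Ω)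
    [IsProbabilityMeasure P] {X : Ω → ℝ} (hX : Measurable X) (hX2 : MemLp X 2 P) {μ σ : ℝ}
    (hμ : ∫ ω, X ω ∂P = μ) (hσ : 0 < σ) (hvar : Var[X; P] = σ ^ 2) {t a : ℝ} (ht : 0 < t)
    (ha : 0 < a) (hta : a ≤ P.real {ω | t < (X ω - μ) / σ}) :
    (t * a) ^ 2 ≤ P.real {ω | X ω ≤ μ} := by
  set S := {ω | t < (X ω - μ) / σ} with hS
  set T := {ω | X ω ≤ μ} with hT
  have hSm : MeasurableSet S := measurableSet_lt measurable_const ((hX.sub_const _).div_const _)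
  have hTm : MeasurableSet T := measurableSet_le hX measurable_const
  set l := t * a with hl
  have hl0 : 0 < l := mul_pos ht ha
  -- On `T` the right side is a completed square; off `T` the term `X - μ` alone suffices.
  -- Integrating gives `σ l ≤ σ l / 2 + σ P(T) / (2 l)`, which is `l² ≤ P(T)`.
  have hpt : ∀ ω, t * σ * S.indicator 1 ω
      ≤ (X ω - μ) + l / (2 * σ) * (X ω - μ) ^ 2 + σ / (2 * l) * T.indicator 1 ω := by
    intro ω
    have hq : 0 ≤ l / (2 * σ) * (X ω - μ) ^ 2 := by positivity
    by_cases h1 : ω ∈ T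
    · have h2 : ω ∉ S := fun h => by
        have h3 : t < (X ω - μ) / σ := h
        have h4 : (X ω - μ) / σ ≤ 0 := div_nonpos_of_nonpos_of_nonneg (sub_nonpos.2 h1) hσ.le
        linarith
      rw [Set.indicator_of_mem h1, Set.indicator_of_notMem h2, Pi.one_apply, mul_one, mul_zero]
      have e : (X ω - μ) + l / (2 * σ) * (X ω - μ) ^ 2 + σ / (2 * l)
          = l / (2 * σ) * ((X ω - μ) + σ / l) ^ 2 := by field_simp; ring
      rw [e]; positivity
    · rw [Set.indicator_of_notMem h1, mul_zero, add_zero]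
      have h0 : μ < X ω := not_le.1 h1
      by_cases h2 : ω ∈ S
      · rw [Set.indicator_of_mem h2, Pi.one_apply, mul_one]
        have h3 : t < (X ω - μ) / σ := h2
        rw [lt_div_iff₀ hσ] at h3
        linarith
      · rw [Set.indicator_of_notMem h2, mul_zero]
        linarith
  have hXi := hX2.integrable one_le_two
  have i1 : Integrable (fun ω => X ω - μ) P := hXi.sub (integrable_const _)
  have i2 : Integrable (fun ω => l / (2 * σ) * (X ω - μ) ^ 2) P :=
    (hX2.sub (memLp_const μ)).integrable_sq.const_mul _
  have i3 : Integrable (fun ω => σ / (2 * l) * T.indicator (1 : Ω → ℝ) ω) P :=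
    ((integrable_const (1 : ℝ)).indicator hTm).const_mul _
  have i4 : Integrable (fun ω => t * σ * S.indicator (1 : Ω → ℝ) ω) P :=
    ((integrable_const (1 : ℝ)).indicator hSm).const_mul _
  have i12 : Integrable (fun ω => (X ω - μ) + l / (2 * σ) * (X ω - μ) ^ 2) P := i1.add i2
  have i123 : Integrable (fun ω => (X ω - μ) + l / (2 * σ) * (X ω - μ) ^ 2
      + σ / (2 * l) * T.indicator (1 : Ω → ℝ) ω) P := i12.add i3
  have h := integral_mono i4 i123 hpt
  have e1 : ∫ ω, (X ω - μ) ∂P = 0 := by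
    rw [integral_sub hXi (integrable_const _), hμ]; simp
  have e2 : ∫ ω, (X ω - μ) ^ 2 ∂P = σ ^ 2 := by
    rw [← hvar, variance_eq_integral hX.aemeasurable, hμ]
  rw [integral_const_mul, integral_indicator_one hSm, integral_add i12 i3, integral_add i1 i2,
    integral_const_mul, integral_const_mul, integral_indicator_one hTm, e1, e2, zero_add] at h
  have h6 : σ * l ≤ t * σ * P.real S := by
    rw [hl]
    calc σ * (t * a) = t * σ * a := by ring
      _ ≤ _ := by gcongr
  have h7 : l / (2 * σ) * σ ^ 2 + σ / (2 * l) * P.real T = σ / (2 * l) * (l ^ 2 + P.real T) := by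
    field_simp
  have h8 : σ * l = σ / (2 * l) * (2 * l ^ 2) := by field_simp
  have h9 : σ / (2 * l) * (2 * l ^ 2) ≤ σ / (2 * l) * (l ^ 2 + P.real T) := by
    rw [← h7, ← h8]; exact h6.trans h
  have h10 := le_of_mul_le_mul_left h9 (by positivity)
  linarith

/-! ### One row of the location-scale model -/

section

variable {n : ℕ}

lemma le_spread (μ σ : Fin n → ℝ) {i j : Fin n} (h : i ≠ j) :
    |(μ i - μ j) / σ i| ≤ spread μ σ :=
  le_ciSup (f := fun p : {p : Fin n × Fin n // p.1 ≠ p.2} =>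
    |(μ p.1.1 - μ p.1.2) / σ p.1.1|) (Set.finite_range _).bddAbove ⟨(i, j), h⟩

lemma le_scaleRatio (σ : Fin n → ℝ) {i j : Fin n} (h : i ≠ j) : σ i / σ j ≤ scaleRatio σ :=
  le_ciSup (f := fun p : {p : Fin n × Fin n // p.1 ≠ p.2} => σ p.1.1 / σ p.1.2)
    (Set.finite_range _).bddAbove ⟨(i, j), h⟩

lemma spread_nonneg (μ σ : Fin n → ℝ) : 0 ≤ spread μ σ :=
  Real.iSup_nonneg fun _ => abs_nonneg _

lemma one_le_scaleRatio (hn : 2 ≤ n) {σ : Fin n → ℝ} (hσ : ∀ i, 0 < σ i) : 1 ≤ scaleRatio σ := by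
  have hij : (⟨0, by omega⟩ : Fin n) ≠ ⟨1, by omega⟩ := by simp
  rcases le_total (σ ⟨0, by omega⟩) (σ ⟨1, by omega⟩) with h | h
  · exact ((one_le_div (hσ _)).2 h).trans (le_scaleRatio σ hij.symm)
  · exact ((one_le_div (hσ _)).2 h).trans (le_scaleRatio σ hij)

variable {Ω : Type*} [MeasurableSpace Ω] {P : Measure Ω} [IsProbabilityMeasure P]
  {X : Fin n → Ω → ℝ} {μ σ : Fin n → ℝ}

lemma survival_le_map (h : LocationScale P X μ σ) (j : Fin n) {t y : ℝ}
    (hy : y ≤ μ j + t * σ j) : survival P X μ σ j t ≤ (P.map (X j)).real (Set.Ioi y) := by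
  rw [map_measureReal_apply (h.measurable j) measurableSet_Ioi]
  refine measureReal_mono fun ω hω => ?_
  have h1 : t < (X j ω - μ j) / σ j := hω
  rw [lt_div_iff₀ (h.sigma_pos j)] at h1
  change y < X j ω
  linarith

lemma map_le_survival (h : LocationScale P X μ σ) (j : Fin n) {t y : ℝ}
    (hy : μ j + t * σ j ≤ y) : (P.map (X j)).real (Set.Ioi y) ≤ survival P X μ σ j t := by
  rw [map_measureReal_apply (h.measurable j) measurableSet_Ioi]
  refine measureReal_mono fun ω hω => ?_
  have h1 : y < X j ω := hω
  change t < (X j ω - μ j) / σ j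
  rw [lt_div_iff₀ (h.sigma_pos j)]
  linarith

/-- Lower bound for the variance of the Hájek projection in terms of survival functions. -/
lemma le_sum_variance_hajek (h : LocationScale P X μ σ) {w : Fin n → ℝ} (hw : AdmissibleWeight w)
    {t₀ a r τ M : ℝ} (ht₀ : 0 < t₀) (ha : 0 < a) (hr : 0 < r) (hτ : 0 < τ) (hM : 0 ≤ M)
    (hnr : 8 ≤ n * r) (h1 : ∀ j, a ≤ survival P X μ σ j t₀)
    (h2 : ∀ j, 2 * r ≤ survival P X μ σ j (max (spread μ σ) t₀))
    (h3 : ∀ j, survival P X μ σ j M ≤ r)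
    (h4 : ∀ j, τ ≤ survival P X μ σ j (spread μ σ + M * scaleRatio σ)) :
    (t₀ * a) ^ 2 / 256 * (n ^ 3 * (r ^ 3 * τ))
      ≤ ∑ k, Var[hajek (fun i => P.map (X i)) w k; P.map (X k)] := by
  have : ∀ i, IsProbabilityMeasure (P.map (X i)) := fun i =>
    Measure.isProbabilityMeasure_map (h.measurable i).aemeasurable
  have hn : 0 < n := by
    rcases Nat.eq_zero_or_pos n with h0 | h0
    · rw [h0] at hnr; norm_num at hnr
    · exact h0
  have hr1 : 2 * r ≤ 1 := (h2 ⟨0, hn⟩).trans measureReal_le_one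
  have hn' : (0 : ℝ) < n := by exact_mod_cast hn
  have hsum := le_sum_of_le_last (f := fun k => Var[hajek (fun i => P.map (X i)) w k; P.map (X k)])
    (fun k => variance_nonneg _ _) (c := (n * r) ^ 2 / 16 * ((t₀ * a) ^ 2 * τ)) (y := n * r / 8)
    (by positivity) (by linarith) (by nlinarith) (fun k hk => ?_)
  · refine le_trans (le_of_eq ?_) hsum
    ring
  · refine le_trans ?_ (le_variance_hajek (fun i => P.map (X i)) hw k (a := μ k)
      (b := μ k + (spread μ σ + M * scaleRatio σ) * σ k) hr (by linarith) hk fun j hj => ?_)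
    · have e1 : (t₀ * a) ^ 2 ≤ (P.map (X k)).real (Set.Iic (μ k)) := by
        rw [map_measureReal_apply (h.measurable k) measurableSet_Iic]
        exact sq_le_measureReal_le_mean P (h.measurable k) (h.memLp k) (h.mean k)
          (h.sigma_pos k) (h.variance k) ht₀ ha (h1 k)
      have e2 := (h4 k).trans (survival_le_map h k le_rfl)
      gcongr
    · have hσj := h.sigma_pos j
      have hσk := h.sigma_pos k
      -- The spread, measured in units of `σ j`, gives `μ k ≤ μ j + R σ j`.
      have e1 : 2 * r ≤ (P.map (X j)).real (Set.Ioi (μ k)) := by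
        refine (h2 j).trans (survival_le_map h j ?_)
        have h5 := (neg_le_abs _).trans (le_spread μ σ hj)
        rw [← neg_div, div_le_iff₀ hσj] at h5
        have h6 := mul_le_mul_of_nonneg_right (le_max_left (spread μ σ) t₀) hσj.le
        linarith
      -- Now the spread is measured in units of `σ k`: from `μ j ≤ μ k + R σ k` and `σ j ≤ ρ σ k`,
      -- the point `b` lies beyond `μ j + M σ j`.
      have e2 : (P.map (X j)).real (Set.Ioi (μ k + (spread μ σ + M * scaleRatio σ) * σ k)) ≤ r := by
        refine (map_le_survival h j ?_).trans (h3 j)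
        have h5 := (neg_le_abs _).trans (le_spread μ σ hj.symm)
        rw [← neg_div, div_le_iff₀ hσk] at h5
        have h6 := le_scaleRatio σ hj
        rw [div_le_iff₀ hσk] at h6
        have h7 := mul_le_mul_of_nonneg_left h6 hM
        nlinarith
      linarith

end

/-! ### Asymptotic normality -/

lemma admissibleWeight_one (n : ℕ) : AdmissibleWeight (fun _ : Fin n => (1 : ℝ)) := fun i hi =>
  ⟨le_rfl, (one_le_div (by exact_mod_cast hi)).2 (by exact_mod_cast i.isLt.le)⟩

lemma admissibleWeight_div (n : ℕ) :
    AdmissibleWeight (fun i : Fin n => (n : ℝ) / ((i : ℕ) : ℝ)) := fun i hi =>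
  ⟨(one_le_div (by exact_mod_cast hi)).2 (by exact_mod_cast i.isLt.le), le_rfl⟩

/-- This is the ratio of the `n log n` bound to a standard deviation of order `n^(4/3)`, on which
both error terms depend. -/
lemma tendsto_mul_log_div_rpow (c : ℝ) :
    Tendsto (fun n : ℕ => 2 * ((n : ℝ) * (2 + Real.log n)) / (c * (n : ℝ) ^ (4 / 3 : ℝ)))
      atTop (𝓝 0) := by
  have h1 : Tendsto (fun x : ℝ => Real.log x / x ^ (1 / 3 : ℝ)) atTop (𝓝 0) :=
    (isLittleO_log_rpow_atTop (by norm_num)).tendsto_div_nhds_zero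
  have h2 : Tendsto (fun x : ℝ => 2 * x ^ (-(1 / 3) : ℝ)) atTop (𝓝 (2 * 0)) :=
    (tendsto_rpow_neg_atTop (by norm_num)).const_mul _
  have h3 := ((h2.add h1).const_mul (2 / c)).comp tendsto_natCast_atTop_atTop
  rw [mul_zero, add_zero, mul_zero] at h3
  refine h3.congr' ?_
  filter_upwards [eventually_gt_atTop 0] with n hn
  have hn' : (0 : ℝ) < n := by exact_mod_cast hn
  have e : (n : ℝ) ^ (4 / 3 : ℝ) = n * (n : ℝ) ^ (1 / 3 : ℝ) := by
    nth_rewrite 2 [← Real.rpow_one (n : ℝ)]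
    rw [← Real.rpow_add hn']; norm_num
  have hp : 0 < (n : ℝ) ^ (1 / 3 : ℝ) := Real.rpow_pos_of_pos hn' _
  simp only [Function.comp]
  rw [e, Real.rpow_neg hn'.le]
  field_simp

section

variable {Ω : ℕ → Type*} [∀ n, MeasurableSpace (Ω n)] {P : ∀ n, Measure (Ω n)}
  [∀ n, IsProbabilityMeasure (P n)] {X : ∀ n, Fin n → Ω n → ℝ} {μ σ : ∀ n, Fin n → ℝ}

/-- Asymptotic normality of weighted rank statistics when the variance of the Hájek projection is
at least of order `n ^ (8 / 3)`. -/
lemma asymptoticallyNormal_of_variance (hX : ∀ n, LocationScale (P n) (X n) (μ n) (σ n))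
    {w : ∀ n, Fin n → ℝ} (hw : ∀ n, AdmissibleWeight (w n)) {d : ℕ → ℝ} (hd : ∀ᶠ n in atTop, 0 < d n)
    {κ : ℝ} (hκ : 0 < κ)
    (hV : ∀ᶠ n : ℕ in atTop, κ * (n : ℝ) ^ (8 / 3 : ℝ) ≤
      ∑ k, Var[hajek (fun i => (P n).map (X n i)) (w n) k; (P n).map (X n k)]) :
    AsymptoticallyNormal P (fun n ω => d n * rankSum (w n) (fun i => X n i ω)) := by
  have hXm : ∀ n, Measurable fun ω => fun i => X n i ω := fun n =>
    measurable_pi_iff.2 fun i => (hX n).measurable i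
  have hUm : ∀ n, Measurable fun ω => d n * rankSum (w n) (fun i => X n i ω) := fun n =>
    ((measurable_rankSum (w n)).comp (hXm n)).const_mul _
  have hTm : ∀ n, Measurable fun ω =>
      (√(Var[fun ω => d n * rankSum (w n) (fun i => X n i ω); P n]))⁻¹ *
        (d n * rankSum (w n) (fun i => X n i ω)
          - ∫ ω', d n * rankSum (w n) (fun i => X n i ω') ∂(P n)) := fun n =>
    ((hUm n).sub_const _).const_mul _
  refine ⟨fun n => (hTm n).aemeasurable, aemeasurable_id, ?_⟩
  -- Lévy's continuity theorem.
  refine ProbabilityMeasure.tendsto_iff_tendsto_charFun.2 fun t => ?_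
  simp only [ProbabilityMeasure.coe_mk]
  have hlim : charFun ((gaussianReal 0 1).map fun x : ℝ => x) t
      = Complex.exp (-((t : ℂ) ^ 2 / 2)) := by
    rw [Measure.map_id', charFun_gaussianReal]
    simp
  rw [hlim, tendsto_iff_norm_sub_tendsto_zero]
  set β : ℕ → ℝ := fun n => 2 * ((n : ℝ) * (2 + Real.log n)) / (√κ * (n : ℝ) ^ (4 / 3 : ℝ))
    with hβ
  have hβ0 : Tendsto β atTop (𝓝 0) := tendsto_mul_log_div_rpow _
  have hβ1 : ∀ᶠ n in atTop, |t| * β n ≤ 1 := by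
    have h := hβ0.const_mul |t|
    rw [mul_zero] at h
    exact h.eventually_le_const zero_lt_one
  have hbound : Tendsto (fun n => 4 * (|t| * β n) * t ^ 2 + |t| * β n) atTop (𝓝 0) := by
    have h := hβ0.const_mul |t|
    have h2 := ((h.const_mul 4).mul_const (t ^ 2)).add h
    simpa using h2
  refine squeeze_zero' (Eventually.of_forall fun n => norm_nonneg _) ?_ hbound
  filter_upwards [hd, hV, hβ1, eventually_gt_atTop 0] with n hdn hVn hβn hn
  have hn' : (0 : ℝ) < n := by exact_mod_cast hn
  have : ∀ i, IsProbabilityMeasure ((P n).map (X n i)) := fun i =>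
    Measure.isProbabilityMeasure_map ((hX n).measurable i).aemeasurable
  set ν : Fin n → Measure ℝ := fun i => (P n).map (X n i) with hν
  have hpi : (P n).map (fun ω i => X n i ω) = Measure.pi ν :=
    (hX n).indep.map_fun_eq_pi_map fun i => ((hX n).measurable i).aemeasurable
  set V := ∑ k, Var[hajek ν (w n) k; ν k] with hVdef
  have hV0 : 0 < V := lt_of_lt_of_le (by positivity) hVn
  set s := √V with hs
  have hs0 : 0 < s := Real.sqrt_pos.2 hV0
  have hsβ : 2 * ((n : ℝ) * (2 + Real.log n)) / s ≤ β n := by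
    have hlog := Real.log_natCast_nonneg n
    have h1 : √κ * (n : ℝ) ^ (4 / 3 : ℝ) ≤ s := by
      refine Real.le_sqrt_of_sq_le ((le_of_eq ?_).trans hVn)
      rw [mul_pow, Real.sq_sqrt hκ.le, ← Real.rpow_natCast, ← Real.rpow_mul hn'.le]
      norm_num
    have hκ' := Real.sqrt_pos.2 hκ
    simp only [hβ]
    gcongr
  have hmain := norm_integral_exp_rankSum_sub_le ν (hw n) hs0 rfl (Real.sq_sqrt hV0.le).symm t
    (by rw [mul_div_assoc]; exact (mul_le_mul_of_nonneg_left hsβ (abs_nonneg t)).trans hβn)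
  have hmean : ∫ ω', d n * rankSum (w n) (fun i => X n i ω') ∂(P n)
      = d n * ∫ y, rankSum (w n) y ∂(Measure.pi ν) := by
    rw [integral_const_mul, ← hpi, integral_map (hXm n).aemeasurable
      (measurable_rankSum (w n)).aestronglyMeasurable]
  have hvar : Var[fun ω => d n * rankSum (w n) (fun i => X n i ω); P n]
      = d n ^ 2 * Var[rankSum (w n); Measure.pi ν] := by
    rw [variance_const_mul, ← hpi, variance_map (measurable_rankSum (w n)).aemeasurable
      (hXm n).aemeasurable]
    rfl
  have hchar : charFun ((P n).map fun ω =>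
      (√(Var[fun ω => d n * rankSum (w n) (fun i => X n i ω); P n]))⁻¹ *
        (d n * rankSum (w n) (fun i => X n i ω)
          - ∫ ω', d n * rankSum (w n) (fun i => X n i ω') ∂(P n))) t
      = ∫ x, Complex.exp (((t * (rankSum (w n) x - ∫ y, rankSum (w n) y ∂(Measure.pi ν))
          / √(Var[rankSum (w n); Measure.pi ν]) : ℝ) : ℂ) * Complex.I) ∂(Measure.pi ν) := by
    have hrm := measurable_rankSum (w n)
    rw [charFun_apply_real, integral_map (hTm n).aemeasurable (by fun_prop), ← hpi,
      integral_map (hXm n).aemeasurable (by fun_prop), hpi, hmean, hvar,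
      Real.sqrt_mul (sq_nonneg _), Real.sqrt_sq hdn.le]
    refine integral_congr_ae (ae_of_all _ fun ω => ?_)
    simp only
    rw [← Complex.ofReal_mul]
    congr 3
    rw [mul_inv]
    field_simp
  rw [hchar]
  refine hmain.trans ?_
  rw [mul_div_assoc]
  gcongr

/-- Asymptotic normality of weighted rank statistics under lower and upper tail bounds. -/
lemma asymptoticallyNormal_of_tailBounds (hX : ∀ n, LocationScale (P n) (X n) (μ n) (σ n))
    {t₀ : ℝ} (ht₀ : 0 < t₀) {lo up : ℝ → ℝ} (hlo : ∀ t, t₀ ≤ t → 0 < lo t)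
    (hT : TailBounds P X μ σ t₀ lo up) {M : ℕ → ℝ}
    (hM : ∀ n, t₀ ≤ M n) (hup : ∀ n, 2 * up (M n) ≤ lo (max (spread (μ n) (σ n)) t₀))
    {c : ℝ} (hc : 0 < c)
    (hrate : ∀ᶠ n : ℕ in atTop, c ≤ (n : ℝ) ^ (1 / 3 : ℝ) *
      (lo (max (spread (μ n) (σ n)) t₀) ^ 3
        * lo (spread (μ n) (σ n) + M n * scaleRatio (σ n))))
    {w : ∀ n, Fin n → ℝ} (hw : ∀ n, AdmissibleWeight (w n)) :
    AsymptoticallyNormal P (fun n ω =>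
      1 / ((n : ℝ) * ((n : ℝ) - 1)) * rankSum (w n) (fun i => X n i ω)) := by
  have ha := hlo t₀ le_rfl
  -- The first factor of `κ` comes from `le_sum_variance_hajek` with `a = lo t₀`; the `8` comes from
  -- cubing `r = lo m / 2`.
  refine asymptoticallyNormal_of_variance hX hw ?_
    (κ := (t₀ * lo t₀) ^ 2 / 256 * (c / 8)) (by positivity) ?_
  · filter_upwards [eventually_ge_atTop 2] with n hn
    have : (2 : ℝ) ≤ n := by exact_mod_cast hn
    have : 0 < (n : ℝ) - 1 := by linarith
    positivity
  · have hbig : ∀ᶠ n : ℕ in atTop, 16 / c ≤ (n : ℝ) ^ (2 / 3 : ℝ) :=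
      ((tendsto_rpow_atTop (by norm_num)).comp tendsto_natCast_atTop_atTop).eventually_ge_atTop _
    filter_upwards [hrate, hbig, eventually_ge_atTop 2] with n hn hnb hn2
    have hn' : (0 : ℝ) < n := by exact_mod_cast (by omega : 0 < n)
    have hsurv : ∀ (j : Fin n) (t : ℝ), t₀ ≤ t → lo t ≤ survival (P n) (X n) (μ n) (σ n) j t ∧
        survival (P n) (X n) (μ n) (σ n) j t ≤ up t := by
      intro j t ht
      -- `TailBounds` speaks of pairs `i ≠ j`, so a bound for `j` alone needs a second index.
      have : Nontrivial (Fin n) := Fin.nontrivial_iff_two_le.2 hn2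
      obtain ⟨i, hi⟩ := exists_ne j
      exact (hT n i j hi t ht).1
    have hR := spread_nonneg (μ n) (σ n)
    have hρ := one_le_scaleRatio hn2 (hX n).sigma_pos
    set m := max (spread (μ n) (σ n)) t₀ with hm
    set T := spread (μ n) (σ n) + M n * scaleRatio (σ n) with hTdef
    have hMn := hM n
    have hT0 : t₀ ≤ T := by
      have : M n * 1 ≤ M n * scaleRatio (σ n) := by gcongr; linarith
      linarith
    have hm0 : t₀ ≤ m := le_max_right _ _
    have hlom := hlo m hm0
    have hloT := hlo T hT0
    have hlom1 : lo m ≤ 1 := ((hsurv ⟨0, by omega⟩ m hm0).1).trans measureReal_le_one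
    have hloT1 : lo T ≤ 1 := ((hsurv ⟨0, by omega⟩ T hT0).1).trans measureReal_le_one
    have hprod : lo m ^ 3 * lo T ≤ lo m := by
      calc lo m ^ 3 * lo T ≤ lo m ^ 3 * 1 := by gcongr
        _ ≤ lo m := by rw [mul_one]; exact pow_le_of_le_one hlom.le hlom1 (by norm_num)
    have e23 : (n : ℝ) = (n : ℝ) ^ (2 / 3 : ℝ) * (n : ℝ) ^ (1 / 3 : ℝ) := by
      rw [← Real.rpow_add hn']; norm_num
    have e83 : (n : ℝ) ^ 3 = (n : ℝ) ^ (8 / 3 : ℝ) * (n : ℝ) ^ (1 / 3 : ℝ) := by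
      rw [← Real.rpow_add hn', ← Real.rpow_natCast]; norm_num
    -- Lower bounds of probabilities are at most one, so the rate condition already gives `lo m ≥ c
    -- n^(-1/3)`, and `n * lo m` is at least of order `n^(2/3)`.
    have hnr : 8 ≤ n * (lo m / 2) := by
      have h1 : c ≤ (n : ℝ) ^ (1 / 3 : ℝ) * lo m := hn.trans (by gcongr)
      have h2 : 16 / c * c ≤ (n : ℝ) ^ (2 / 3 : ℝ) * ((n : ℝ) ^ (1 / 3 : ℝ) * lo m) := by gcongr
      rw [← mul_assoc, ← e23, div_mul_cancel₀ _ hc.ne'] at h2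
      linarith
    refine le_trans ?_ (le_sum_variance_hajek (hX n) (hw n) ht₀ ha (half_pos hlom) hloT
      (ht₀.le.trans hMn) hnr (fun j => (hsurv j t₀ le_rfl).1) (fun j => ?_) (fun j => ?_)
      (fun j => (hsurv j T hT0).1))
    · have h1 : c * (n : ℝ) ^ (8 / 3 : ℝ)
          ≤ ((n : ℝ) ^ (1 / 3 : ℝ) * (lo m ^ 3 * lo T)) * (n : ℝ) ^ (8 / 3 : ℝ) := by gcongr
      rw [mul_assoc]
      refine mul_le_mul_of_nonneg_left ?_ (by positivity)
      rw [e83]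
      calc c / 8 * (n : ℝ) ^ (8 / 3 : ℝ) = 1 / 8 * (c * (n : ℝ) ^ (8 / 3 : ℝ)) := by ring
        _ ≤ 1 / 8 * (((n : ℝ) ^ (1 / 3 : ℝ) * (lo m ^ 3 * lo T)) * (n : ℝ) ^ (8 / 3 : ℝ)) := by
            gcongr
        _ = _ := by ring
    · rw [mul_div_cancel₀ _ two_ne_zero]
      exact (hsurv j m hm0).1
    · have h1 := (hsurv j (M n) hMn).2
      have h2 := hup n
      linarith

/-! ### Polynomial tails -/

/-- With `m = max R t₀`, matching `2 c₂ M^(-b₂) ≤ c₁ m^(-b₁)` forces `M` of order `m^(b₁ / b₂)`.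
Then `R + M ρ` is at most of order `m^(b₁ / b₂) ρ`, and `lo(m)³ lo(R + M ρ)` is at least a constant
times the inverse of `m^(3 b₁ + b₁² / b₂) ρ^(b₁)`, which is where the exponent in `heavyRate` comes
from. -/
lemma asymptoticallyNormal_of_heavyTails (hX : ∀ n, LocationScale (P n) (X n) (μ n) (σ n))
    {c₁ c₂ b₁ b₂ t₀ : ℝ} (hc₁ : 0 < c₁) (hc₂ : 0 < c₂) (hb₂ : 0 < b₂) (hb : b₂ < b₁)
    (ht₀ : 0 < t₀)
    (hT : TailBounds P X μ σ t₀ (fun t => c₁ * t ^ (-b₁)) (fun t => c₂ * t ^ (-b₂)))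
    (h1 : (fun n => heavyRate b₁ b₂ (spread (μ n) (σ n)) (scaleRatio (σ n))) =O[atTop]
      (fun n : ℕ => (n : ℝ) ^ (1 / 3 : ℝ)))
    (h2 : (fun n => scaleRatio (σ n) ^ b₁) =O[atTop] (fun n : ℕ => (n : ℝ) ^ (1 / 3 : ℝ)))
    {w : ∀ n, Fin n → ℝ} (hw : ∀ n, AdmissibleWeight (w n)) :
    AsymptoticallyNormal P (fun n ω =>
      1 / ((n : ℝ) * ((n : ℝ) - 1)) * rankSum (w n) (fun i => X n i ω)) := by
  have hb₁ : 0 < b₁ := hb₂.trans hb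
  set β := b₁ / b₂ with hβ
  have hβb : β * b₂ = b₁ := div_mul_cancel₀ _ hb₂.ne'
  have hβ1 : 1 < β := (one_lt_div hb₂).2 hb
  set e := (3 * b₁ * b₂ + b₁ ^ 2) / b₂ with he
  have he' : e = 3 * b₁ + β * b₁ := by rw [he, hβ]; field_simp
  have he0 : 0 < e := by positivity
  -- The first entry makes the upper tail at `M` small enough, the second ensures `M ≥ t₀`.
  set C₀ := max ((2 * c₂ / c₁) ^ (1 / b₂)) (t₀ ^ (1 - β)) with hC₀
  have hC₀pos : 0 < C₀ := lt_of_lt_of_le (by positivity) (le_max_right _ _)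
  set D := t₀ ^ (1 - β) + C₀ with hD
  have hDpos : 0 < D := by positivity
  obtain ⟨A₁, hA₁, hA₁'⟩ := h1.exists_pos
  obtain ⟨A₂, hA₂, hA₂'⟩ := h2.exists_pos
  have hm0 : ∀ n, t₀ ≤ max (spread (μ n) (σ n)) t₀ := fun n => le_max_right _ _
  have hsplit : ∀ m, t₀ ≤ m → t₀ ^ (1 - β) * t₀ ^ β = t₀ ∧ m ≤ t₀ ^ (1 - β) * m ^ β := by
    intro m hm
    have hmpos := ht₀.trans_le hm
    refine ⟨by rw [← Real.rpow_add ht₀]; simp, ?_⟩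
    have h3 : m ^ (1 - β) ≤ t₀ ^ (1 - β) :=
      Real.rpow_le_rpow_of_nonpos ht₀ hm (by linarith)
    calc m = m ^ (1 - β) * m ^ β := by rw [← Real.rpow_add hmpos]; simp
      _ ≤ _ := by gcongr
  refine asymptoticallyNormal_of_tailBounds hX ht₀ (fun t ht => ?_) hT
    (M := fun n => C₀ * max (spread (μ n) (σ n)) t₀ ^ β) (fun n => ?_) (fun n => ?_)
    (c := c₁ ^ 4 * D ^ (-b₁) / (A₁ + t₀ ^ e * A₂)) (by positivity) ?_ hw
  · have := ht₀.trans_le ht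
    positivity
  · refine (hsplit _ (hm0 n)).2.trans' (hm0 n) |>.trans ?_
    gcongr
    exact le_max_right _ _
  · set m := max (spread (μ n) (σ n)) t₀
    have hmpos : 0 < m := ht₀.trans_le (hm0 n)
    rw [Real.mul_rpow hC₀pos.le (by positivity), ← Real.rpow_mul hmpos.le, mul_neg, hβb]
    have h3 : 2 * c₂ / c₁ ≤ C₀ ^ b₂ := by
      calc 2 * c₂ / c₁ = ((2 * c₂ / c₁) ^ (1 / b₂)) ^ b₂ := by
            rw [← Real.rpow_mul (by positivity), one_div, inv_mul_cancel₀ hb₂.ne', Real.rpow_one]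
        _ ≤ C₀ ^ b₂ := by
            gcongr
            exact le_max_left _ _
    have h4 : 2 * c₂ * C₀ ^ (-b₂) ≤ c₁ := by
      rw [div_le_iff₀ hc₁] at h3
      rw [Real.rpow_neg hC₀pos.le, ← div_eq_mul_inv, div_le_iff₀ (by positivity)]
      linarith
    calc 2 * (c₂ * (C₀ ^ (-b₂) * m ^ (-b₁))) = 2 * c₂ * C₀ ^ (-b₂) * m ^ (-b₁) := by ring
      _ ≤ _ := by gcongr
  · filter_upwards [hA₁'.bound, hA₂'.bound, eventually_ge_atTop 2] with n hn1 hn2 hn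
    have hn' : (0 : ℝ) < n := by exact_mod_cast (by omega : 0 < n)
    have hR := spread_nonneg (μ n) (σ n)
    have hρ := one_le_scaleRatio hn (hX n).sigma_pos
    set R := spread (μ n) (σ n)
    set ρ := scaleRatio (σ n)
    set m := max R t₀ with hm
    have hmpos : 0 < m := ht₀.trans_le (hm0 n)
    have hρpos : 0 < ρ := by linarith
    have hn3 : 0 < (n : ℝ) ^ (1 / 3 : ℝ) := by positivity
    have hNn : ‖(n : ℝ) ^ (1 / 3 : ℝ)‖ = (n : ℝ) ^ (1 / 3 : ℝ) := by
      rw [Real.norm_eq_abs, abs_of_pos hn3]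
    rw [hNn] at hn1 hn2
    have hn1' : R ^ e * ρ ^ b₁ ≤ A₁ * (n : ℝ) ^ (1 / 3 : ℝ) := (le_abs_self _).trans hn1
    have hn2' : ρ ^ b₁ ≤ A₂ * (n : ℝ) ^ (1 / 3 : ℝ) := (le_abs_self _).trans hn2
    -- The `R^e` part is controlled by the first growth condition, the `t₀^e` part, relevant when
    -- `R` is small, by the second.
    have hmρ : m ^ e * ρ ^ b₁ ≤ (A₁ + t₀ ^ e * A₂) * (n : ℝ) ^ (1 / 3 : ℝ) := by
      have h3 : m ^ e ≤ R ^ e + t₀ ^ e := by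
        rcases le_total R t₀ with h | h
        · rw [hm, max_eq_right h]
          exact le_add_of_nonneg_left (by positivity)
        · rw [hm, max_eq_left h]
          exact le_add_of_nonneg_right (by positivity)
      calc m ^ e * ρ ^ b₁ ≤ (R ^ e + t₀ ^ e) * ρ ^ b₁ := by gcongr
        _ = R ^ e * ρ ^ b₁ + t₀ ^ e * ρ ^ b₁ := by ring
        _ ≤ A₁ * (n : ℝ) ^ (1 / 3 : ℝ) + t₀ ^ e * (A₂ * (n : ℝ) ^ (1 / 3 : ℝ)) := by gcongr
        _ = _ := by ring
    have hT0 : 0 < R + C₀ * m ^ β * ρ := by positivity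
    have hTle : R + C₀ * m ^ β * ρ ≤ D * m ^ β * ρ := by
      have h3 : R ≤ t₀ ^ (1 - β) * m ^ β * ρ := by
        refine (le_max_left R t₀).trans ((hsplit m (hm0 n)).2.trans ?_)
        exact le_mul_of_one_le_right (by positivity) hρ
      rw [hD]; linarith
    have hlow : D ^ (-b₁) * (m ^ β) ^ (-b₁) * ρ ^ (-b₁) ≤ (R + C₀ * m ^ β * ρ) ^ (-b₁) := by
      rw [← Real.mul_rpow hDpos.le (by positivity), ← Real.mul_rpow (by positivity) hρpos.le]
      exact Real.rpow_le_rpow_of_nonpos hT0 hTle (by linarith)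
    have hcomb : (m ^ (-b₁)) ^ 3 * ((m ^ β) ^ (-b₁) * ρ ^ (-b₁)) = (m ^ e * ρ ^ b₁)⁻¹ := by
      rw [mul_inv, ← Real.rpow_neg hmpos.le, ← Real.rpow_neg hρpos.le, ← Real.rpow_natCast,
        ← Real.rpow_mul hmpos.le, ← Real.rpow_mul hmpos.le, ← mul_assoc, ← Real.rpow_add hmpos, he']
      congr 2
      push_cast; ring
    rw [div_le_iff₀ (by positivity)]
    calc c₁ ^ 4 * D ^ (-b₁)
        = c₁ ^ 4 * D ^ (-b₁) * ((m ^ e * ρ ^ b₁)⁻¹ * (m ^ e * ρ ^ b₁)) := by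
          rw [inv_mul_cancel₀ (by positivity), mul_one]
      _ ≤ c₁ ^ 4 * D ^ (-b₁) *
          ((m ^ e * ρ ^ b₁)⁻¹ * ((A₁ + t₀ ^ e * A₂) * (n : ℝ) ^ (1 / 3 : ℝ))) := by gcongr
      _ = (n : ℝ) ^ (1 / 3 : ℝ) * ((c₁ * m ^ (-b₁)) ^ 3 *
            (c₁ * (D ^ (-b₁) * (m ^ β) ^ (-b₁) * ρ ^ (-b₁)))) * (A₁ + t₀ ^ e * A₂) := by
          rw [← hcomb]; ring
      _ ≤ _ := by gcongr

/-! ### Weibull-type tails -/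

/-- Subadditivity of the power for `p ≤ 1`, convexity for `p > 1`. -/
lemma add_rpow_le_xi_mul {x y p : ℝ} (hx : 0 ≤ x) (hy : 0 ≤ y) (hp : 0 < p) :
    (x + y) ^ p ≤ xi p * (x ^ p + y ^ p) := by
  unfold xi
  split_ifs with h
  · rw [one_mul]
    exact Real.rpow_add_le_add_rpow hx hy hp.le h
  · have := NNReal.rpow_add_le_mul_rpow_add_rpow ⟨x, hx⟩ ⟨y, hy⟩ (not_le.1 h).le
    exact_mod_cast this

lemma xi_nonneg (p : ℝ) : 0 ≤ xi p := by
  unfold xi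
  split_ifs <;> positivity

/-- The left side is the smallest value of `M ^ l` with `2 * up M ≤ lo (max R t₀)`. Its root is
majorized by an affine function of `R`: the second term of `K₃` covers `R ≤ t₀`, while its third
term and `K₄` cover `R ≥ t₀`. The summand `t₀` in `K₃` keeps `M` above the threshold. -/
lemma rpow_max_le {c₁ c₂ b₁ b₂ t₀ l R : ℝ}
    (hD : 0 ≤ -(1 / b₂) * Real.log (c₁ / (2 * c₂))) (hb₂ : 0 < b₂) (hb₁ : 0 < b₁) (ht₀ : 0 < t₀)
    (hl : 0 < l) (hR : 0 ≤ R) :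
    -(1 / b₂) * Real.log (c₁ / (2 * c₂)) + b₁ / b₂ * max R t₀ ^ l
      ≤ (K₃ c₁ c₂ b₁ b₂ t₀ l + K₄ b₁ b₂ l * R) ^ l := by
  unfold K₃ K₄
  set D := -(1 / b₂) * Real.log (c₁ / (2 * c₂))
  have hxi := xi_nonneg (1 / l)
  have hl' : 0 < 1 / l := by positivity
  have hm : 0 < max R t₀ := lt_max_of_lt_right ht₀
  have key : (D + b₁ / b₂ * max R t₀ ^ l) ^ (1 / l)
      ≤ t₀ + (D + b₁ / b₂ * t₀ ^ l) ^ (1 / l) + xi (1 / l) * D ^ (1 / l)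
        + xi (1 / l) * (b₁ / b₂) ^ (1 / l) * R := by
    have p1 : 0 ≤ (D + b₁ / b₂ * t₀ ^ l) ^ (1 / l) := by positivity
    have p2 : 0 ≤ xi (1 / l) * D ^ (1 / l) := by positivity
    have p3 : 0 ≤ xi (1 / l) * (b₁ / b₂) ^ (1 / l) * R := by positivity
    rcases le_total R t₀ with h | h
    · rw [max_eq_right h]; linarith
    · rw [max_eq_left h]
      have h1 := add_rpow_le_xi_mul hD (y := b₁ / b₂ * R ^ l) (by positivity) hl'
      rw [Real.mul_rpow (x := b₁ / b₂) (y := R ^ l) (by positivity) (by positivity),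
        ← Real.rpow_mul hR, mul_one_div_cancel hl.ne', Real.rpow_one] at h1
      linarith
  calc D + b₁ / b₂ * max R t₀ ^ l = ((D + b₁ / b₂ * max R t₀ ^ l) ^ (1 / l)) ^ l := by
        rw [← Real.rpow_mul (by positivity), one_div_mul_cancel hl.ne', Real.rpow_one]
    _ ≤ _ := by gcongr

/-- For `M = K₃ + K₄ R` the point `R + M ρ` is the bracket in `lightRate`. Since `max R t₀ ^ l ≤ R ^
l + t₀ ^ l`, the product `lo(max R t₀)³ lo(R + M ρ)` is at least a constant times `exp (-L)`. -/
lemma asymptoticallyNormal_of_lightTails (hX : ∀ n, LocationScale (P n) (X n) (μ n) (σ n))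
    {c₁ c₂ b₁ b₂ t₀ l : ℝ} (hc₁ : 0 < c₁) (hc₂ : 0 < c₂) (hc : c₁ ≤ 2 * c₂) (hb₂ : 0 < b₂)
    (hb : b₂ < b₁) (ht₀ : 0 < t₀) (hl : 0 < l)
    (hT : TailBounds P X μ σ t₀ (fun t => c₁ * Real.exp (-b₁ * t ^ l))
        (fun t => c₂ * Real.exp (-b₂ * t ^ l)))
    (h : (fun n => Real.exp (lightRate c₁ c₂ b₁ b₂ t₀ l (spread (μ n) (σ n)) (scaleRatio (σ n))))
      =O[atTop] (fun n : ℕ => (n : ℝ) ^ (1 / 3 : ℝ)))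
    {w : ∀ n, Fin n → ℝ} (hw : ∀ n, AdmissibleWeight (w n)) :
    AsymptoticallyNormal P (fun n ω =>
      1 / ((n : ℝ) * ((n : ℝ) - 1)) * rankSum (w n) (fun i => X n i ω)) := by
  have hb₁ : 0 < b₁ := hb₂.trans hb
  -- This is where `c₁ ≤ 2 c₂` enters: it makes the base of the real power nonnegative.
  have hD : 0 ≤ -(1 / b₂) * Real.log (c₁ / (2 * c₂)) := by
    have : Real.log (c₁ / (2 * c₂)) ≤ 0 :=
      Real.log_nonpos (by positivity) ((div_le_one (by positivity)).2 hc)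
    have h1 : 0 < 1 / b₂ := by positivity
    nlinarith
  have hxi := xi_nonneg (1 / l)
  have hK₄ : 0 ≤ K₄ b₁ b₂ l := by unfold K₄; positivity
  have hK₃ : t₀ ≤ K₃ c₁ c₂ b₁ b₂ t₀ l := by
    unfold K₃
    have p1 : 0 ≤ (-(1 / b₂) * Real.log (c₁ / (2 * c₂)) + b₁ / b₂ * t₀ ^ l) ^ (1 / l) := by
      positivity
    have p2 : 0 ≤ xi (1 / l) * (-(1 / b₂) * Real.log (c₁ / (2 * c₂))) ^ (1 / l) := by positivity
    linarith
  obtain ⟨A, hA, hA'⟩ := h.exists_pos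
  refine asymptoticallyNormal_of_tailBounds hX ht₀ (fun t _ => by positivity) hT
    (M := fun n => K₃ c₁ c₂ b₁ b₂ t₀ l + K₄ b₁ b₂ l * spread (μ n) (σ n)) (fun n => ?_)
    (fun n => ?_) (c := c₁ ^ 4 * Real.exp (-(3 * b₁ * t₀ ^ l)) / A) (by positivity) ?_ hw
  · have := mul_nonneg hK₄ (spread_nonneg (μ n) (σ n))
    linarith
  · have hR := spread_nonneg (μ n) (σ n)
    have h1 := mul_le_mul_of_nonneg_left (rpow_max_le hD hb₂ hb₁ ht₀ hl hR) hb₂.le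
    set M := K₃ c₁ c₂ b₁ b₂ t₀ l + K₄ b₁ b₂ l * spread (μ n) (σ n)
    set m := max (spread (μ n) (σ n)) t₀
    have h2 : b₂ * (-(1 / b₂) * Real.log (c₁ / (2 * c₂)) + b₁ / b₂ * m ^ l)
        = -Real.log (c₁ / (2 * c₂)) + b₁ * m ^ l := by field_simp
    rw [h2] at h1
    calc 2 * (c₂ * Real.exp (-b₂ * M ^ l))
        ≤ 2 * (c₂ * Real.exp (Real.log (c₁ / (2 * c₂)) + -b₁ * m ^ l)) := by
          gcongr; linarith
      _ = c₁ * Real.exp (-b₁ * m ^ l) := by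
          rw [Real.exp_add, Real.exp_log (by positivity)]; field_simp
  · filter_upwards [hA'.bound, eventually_ge_atTop 2] with n hn1 hn
    have hn' : (0 : ℝ) < n := by exact_mod_cast (by omega : 0 < n)
    have hR := spread_nonneg (μ n) (σ n)
    set R := spread (μ n) (σ n)
    set ρ := scaleRatio (σ n)
    set L := lightRate c₁ c₂ b₁ b₂ t₀ l R ρ with hL
    have hn3 : 0 < (n : ℝ) ^ (1 / 3 : ℝ) := by positivity
    rw [Real.norm_eq_abs, Real.norm_eq_abs, abs_of_pos hn3, abs_of_pos (Real.exp_pos _)] at hn1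
    have hm : max R t₀ ^ l ≤ R ^ l + t₀ ^ l := by
      rcases le_total R t₀ with h | h
      · rw [max_eq_right h]
        exact le_add_of_nonneg_left (by positivity)
      · rw [max_eq_left h]
        exact le_add_of_nonneg_right (by positivity)
    have hTeq : R + (K₃ c₁ c₂ b₁ b₂ t₀ l + K₄ b₁ b₂ l * R) * ρ
        = R + K₃ c₁ c₂ b₁ b₂ t₀ l * ρ + K₄ b₁ b₂ l * ρ * R := by ring
    have hexp : Real.exp (-(3 * b₁ * t₀ ^ l)) * Real.exp (-L)
        ≤ Real.exp (-b₁ * max R t₀ ^ l) ^ 3 *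
          Real.exp (-b₁ * (R + (K₃ c₁ c₂ b₁ b₂ t₀ l + K₄ b₁ b₂ l * R) * ρ) ^ l) := by
      rw [← Real.exp_nat_mul, ← Real.exp_add, ← Real.exp_add, hTeq, hL, lightRate]
      refine Real.exp_le_exp.2 ?_
      have := mul_le_mul_of_nonneg_left hm hb₁.le
      push_cast
      linarith
    rw [div_le_iff₀ hA]
    calc c₁ ^ 4 * Real.exp (-(3 * b₁ * t₀ ^ l))
        = c₁ ^ 4 * (Real.exp (-(3 * b₁ * t₀ ^ l)) * Real.exp (-L)) * Real.exp L := by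
          have hLL : Real.exp (-L) * Real.exp L = 1 := by
            rw [← Real.exp_add, neg_add_cancel, Real.exp_zero]
          linear_combination -(c₁ ^ 4 * Real.exp (-(3 * b₁ * t₀ ^ l))) * hLL
      _ ≤ c₁ ^ 4 * (Real.exp (-b₁ * max R t₀ ^ l) ^ 3 *
          Real.exp (-b₁ * (R + (K₃ c₁ c₂ b₁ b₂ t₀ l + K₄ b₁ b₂ l * R) * ρ) ^ l))
            * (A * (n : ℝ) ^ (1 / 3 : ℝ)) := by gcongr
      _ = _ := by ring

end

/-! ### Comparison of the growth conditions with `n^(1/3)` -/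

lemma eventually_one_le_log : ∀ᶠ n : ℕ in atTop, 1 ≤ Real.log n :=
  (Real.tendsto_log_atTop.comp tendsto_natCast_atTop_atTop).eventually_ge_atTop 1

lemma rpow_mul_log_isBigO :
    (fun n : ℕ => (n : ℝ) ^ (1 / 3 : ℝ) * Real.log n ^ (-2 : ℝ))
      =O[atTop] (fun n : ℕ => (n : ℝ) ^ (1 / 3 : ℝ)) := by
  refine IsBigO.of_bound 1 ?_
  filter_upwards [eventually_one_le_log] with n hn
  rw [one_mul, norm_mul]
  refine mul_le_of_le_one_right (norm_nonneg _) ?_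
  rw [Real.norm_eq_abs, abs_of_nonneg (by positivity)]
  exact Real.rpow_le_one_of_one_le_of_nonpos hn (by norm_num)

lemma exp_log_isBigO :
    (fun n : ℕ => Real.exp (1 / 3 * Real.log n))
      =O[atTop] (fun n : ℕ => (n : ℝ) ^ (1 / 3 : ℝ)) := by
  refine IsBigO.of_bound 1 ?_
  -- The two functions agree for `n > 0`; at `n = 0` they are `1` and `0`.
  filter_upwards [eventually_gt_atTop 0] with n hn
  rw [Real.rpow_def_of_pos (by exact_mod_cast hn), mul_comm, one_mul]

lemma exp_log_sub_isBigO :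
    (fun n : ℕ => Real.exp (1 / 3 * Real.log n - 2 * Real.log (Real.log n)))
      =O[atTop] (fun n : ℕ => (n : ℝ) ^ (1 / 3 : ℝ)) := by
  refine IsBigO.trans (IsBigO.of_bound 1 ?_) exp_log_isBigO
  filter_upwards [eventually_one_le_log] with n hn
  have := Real.log_nonneg hn
  rw [one_mul, Real.norm_eq_abs, Real.norm_eq_abs, abs_of_pos (Real.exp_pos _),
    abs_of_pos (Real.exp_pos _)]
  exact Real.exp_le_exp.2 (by linarith)

end RankCLT

end

theorem mainTheorem7 {Ω : ℕ → Type*} [∀ n, MeasurableSpace (Ω n)]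
    (P : ∀ n, Measure (Ω n)) [∀ n, IsProbabilityMeasure (P n)]
    (X : ∀ n, Fin n → Ω n → ℝ) (μ σ : ∀ n, Fin n → ℝ)
    (hX : ∀ n, RankCLT.LocationScale (P n) (X n) (μ n) (σ n)) :
    -- polynomial tails
    (∀ c₁ c₂ b₁ b₂ t₀ : ℝ, 0 < c₁ → 0 < c₂ → 0 < b₂ → b₂ < b₁ → 0 < t₀ →
      RankCLT.TailBounds P X μ σ t₀ (fun t => c₁ * t ^ (-b₁)) (fun t => c₂ * t ^ (-b₂)) →
      ((RankCLT.StrictlyLesssim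
            (fun n => RankCLT.heavyRate b₁ b₂ (RankCLT.spread (μ n) (σ n))
              (RankCLT.scaleRatio (σ n)))
            (fun n => (n : ℝ) ^ (1 / 3 : ℝ)) →
          (fun n => RankCLT.scaleRatio (σ n) ^ b₁) =O[atTop]
            (fun n : ℕ => (n : ℝ) ^ (1 / 3 : ℝ)) →
          RankCLT.AsymptoticallyNormal P (fun n ω => RankCLT.kendall (fun i => X n i ω))) ∧
        (RankCLT.StrictlyLesssim
            (fun n => RankCLT.heavyRate b₁ b₂ (RankCLT.spread (μ n) (σ n))
              (RankCLT.scaleRatio (σ n)))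
            (fun n => (n : ℝ) ^ (1 / 3 : ℝ) * Real.log n ^ (-2 : ℝ)) →
          (fun n => RankCLT.scaleRatio (σ n) ^ b₁) =O[atTop]
            (fun n : ℕ => (n : ℝ) ^ (1 / 3 : ℝ) * Real.log n ^ (-2 : ℝ)) →
          RankCLT.AsymptoticallyNormal P
            (fun n ω => RankCLT.avgPrecision (fun i => X n i ω))))) ∧
    -- Weibull-type tails
    (∀ c₁ c₂ b₁ b₂ t₀ l : ℝ, 0 < c₁ → 0 < c₂ → c₁ ≤ 2 * c₂ → 0 < b₂ → b₂ < b₁ → 0 < t₀ →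
      0 < l →
      RankCLT.TailBounds P X μ σ t₀ (fun t => c₁ * Real.exp (-b₁ * t ^ l))
        (fun t => c₂ * Real.exp (-b₂ * t ^ l)) →
      ((RankCLT.StrictlyLesssim
            (fun n => Real.exp (RankCLT.lightRate c₁ c₂ b₁ b₂ t₀ l
              (RankCLT.spread (μ n) (σ n)) (RankCLT.scaleRatio (σ n))))
            (fun n => Real.exp (1 / 3 * Real.log n)) →
          RankCLT.AsymptoticallyNormal P (fun n ω => RankCLT.kendall (fun i => X n i ω))) ∧
        (RankCLT.StrictlyLesssim
            (fun n => Real.exp (RankCLT.lightRate c₁ c₂ b₁ b₂ t₀ l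
              (RankCLT.spread (μ n) (σ n)) (RankCLT.scaleRatio (σ n))))
            (fun n => Real.exp (1 / 3 * Real.log n - 2 * Real.log (Real.log n))) →
          RankCLT.AsymptoticallyNormal P
            (fun n ω => RankCLT.avgPrecision (fun i => X n i ω))))) := by
  refine ⟨fun c₁ c₂ b₁ b₂ t₀ hc₁ hc₂ hb₂ hb ht₀ hT => ⟨fun h1 h2 => ?_, fun h1 h2 => ?_⟩,
    fun c₁ c₂ b₁ b₂ t₀ l hc₁ hc₂ hc hb₂ hb ht₀ hl hT => ⟨fun h => ?_, fun h => ?_⟩⟩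
  -- By unfolding, `kendall` and `avgPrecision` are `1 / (n (n - 1))` times `rankSum` with weights
  -- `1` and `n / i`.
  · exact RankCLT.asymptoticallyNormal_of_heavyTails hX hc₁ hc₂ hb₂ hb ht₀ hT h1.1 h2
      fun n => RankCLT.admissibleWeight_one n
  · exact RankCLT.asymptoticallyNormal_of_heavyTails hX hc₁ hc₂ hb₂ hb ht₀ hT
      (h1.1.trans RankCLT.rpow_mul_log_isBigO) (h2.trans RankCLT.rpow_mul_log_isBigO)
      fun n => RankCLT.admissibleWeight_div n
  · exact RankCLT.asymptoticallyNormal_of_lightTails hX hc₁ hc₂ hc hb₂ hb ht₀ hl hT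
      (h.1.trans RankCLT.exp_log_isBigO) fun n => RankCLT.admissibleWeight_one n
  · exact RankCLT.asymptoticallyNormal_of_lightTails hX hc₁ hc₂ hc hb₂ hb ht₀ hl hT
      (h.1.trans RankCLT.exp_log_sub_isBigO) fun n => RankCLT.admissibleWeight_div n
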